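/- Let $k$ be a field of characteristic $p>0$, let $S=k[x_0,\dots,x_n]$ with the standard grading, $\mathfrak m=(x_0,\dots,x_n)$, and let $f_1,\dots,f_c\in S$ be homogeneous polynomials forming a regular sequence (in particular $J:=(f_1,\dots,f_c)\neq S$). Set $R=S/J$. For an ideal $I\subseteq S$ put $I^{[p]}=(a^p\mid a\in I)$. For a graded module $M$ with $M_t=0$ for $t\gg 0$ put $\mathrm{reg}(M)=\max\{t\mid M_t\neq 0\}$, and let $a(R)=\mathrm{reg}\big(H^{\dim R}_{\mathfrak m}(R)\big)$; this maximum exists and $a(R)=\sum_{i=1}^c\deg f_i-(n+1)$. Local cohomology is computed by the Čech complex on $x_0,\dots,x_n$, with its induced $\mathbb Z$-grading and Frobenius action $F$. There is a smallest ideal $\tau$ of $S$ such that $J\subseteq\tau$ and $(f_1\cdots f_c)^{p-1}\in\tau^{[p]}$, and $\tau$ is homogeneous. Assume $\sqrt\tau=\mathfrak m$. Then $\mathrm{reg}(S/\tau)=\max\{t\mid (S/\tau)_t\ne 0\}$ exists, and with $b=a(R)-\mathrm{reg}(S/\tau)$ the Frobenius action restricts to an injective map \[ F: H^{n+1-c}_{\mathfrak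 m}(R)_{<b}\longrightarrow H^{n+1-c}_{\mathfrak m}(R)_{<pb}, \] where $(-)_{<b}$ denotes the sum of the graded pieces of degree less than $b$. The bound is sharp: there is a nonzero class $\alpha\in H^{n+1-c}_{\mathfrak m}(R)$ homogeneous of degree exactly $b$ with $F(\alpha)=0$. -/

import Mathlib

noncomputable section

/-! ### Čech cohomology of a commutative ring and its Frobenius action -/

namespace Cech

variable {A : Type*} [CommRing A] {N : ℕ} (x : Fin N → A)

/-- The localization `A_{x_s}`, where `x_s = ∏_{j ∈ s} x_j`. -/
abbrev Loc (s : Finset (Fin N)) : Type _ := Localization.Away (∏ j ∈ s, x j)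

theorem isUnit_algebraMap {s t : Finset (Fin N)} (h : s ⊆ t)
    (y : Submonoid.powers (∏ j ∈ s, x j)) :
    IsUnit (Algebra.ofId A (Loc x t) y) := by
  obtain ⟨_, m, rfl⟩ := y
  have h1 : IsUnit (algebraMap A (Loc x t) (∏ j ∈ t, x j)) :=
    IsLocalization.Away.algebraMap_isUnit _
  have h2 : IsUnit (algebraMap A (Loc x t) (∏ j ∈ s, x j)) :=
    isUnit_of_dvd_unit (map_dvd _ (Finset.prod_dvd_prod_of_subset s t x h)) h1
  simpa [Algebra.ofId_apply] using h2.pow m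

/-- The canonical map `A_{x_s} → A_{x_t}` for `s ⊆ t`. -/
def res {s t : Finset (Fin N)} (h : s ⊆ t) : Loc x s →ₐ[A] Loc x t :=
  IsLocalization.liftAlgHom (M := Submonoid.powers (∏ j ∈ s, x j))
    (f := Algebra.ofId A (Loc x t)) (isUnit_algebraMap x h)

/-- The total cochain module `∏_s A_{x_s}` of the Čech complex on `x`, where `s` runs over all
subsets of the index set; the factor of `s` sits in cohomological degree `#s`. -/
abbrev Cochain : Type _ := (s : Finset (Fin N)) → Loc x s

/-- The Čech differential `(dα)_s = ∑_{j ∈ s} (-1)^{#{l ∈ s | l < j}} α_{s ∖ {j}}|_{A_{x_s}}`. -/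
def d : Cochain x →ₗ[A] Cochain x :=
  LinearMap.pi fun s => ∑ j ∈ s, (-1 : A) ^ (s.filter (· < j)).card •
    ((res x (Finset.erase_subset j s)).toLinearMap ∘ₗ LinearMap.proj (s.erase j))

theorem res_res {s t u : Finset (Fin N)} (h : s ⊆ t) (h' : t ⊆ u) (z : Loc x s) :
    res x h' (res x h z) = res x (h.trans h') z := by
  have : (res x h').comp (res x h) = res x (h.trans h') :=
    IsLocalization.algHom_ext (Submonoid.powers (∏ j ∈ s, x j)) (by ext)
  exact DFunLike.congr_fun this z

theorem res_congr {s s' t : Finset (Fin N)} (e : s = s') (h : s ⊆ t) (h' : s' ⊆ t) (α : Cochain x) :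
    res x h (α s) = res x h' (α s') := by subst e; rfl

theorem d_apply (α : Cochain x) (s : Finset (Fin N)) :
    d x α s = ∑ j ∈ s, (-1 : A) ^ (s.filter (· < j)).card •
      res x (Finset.erase_subset j s) (α (s.erase j)) := by
  simp [d, LinearMap.pi_apply, LinearMap.sum_apply]

theorem card_aux {s : Finset (Fin N)} {i j : Fin N} (hi : i ∈ s) (h : i < j) :
    (s.filter (· < j)).card = ((s.erase i).filter (· < j)).card + 1 ∧
    ((s.erase j).filter (· < i)).card = (s.filter (· < i)).card := by
  constructor
  · rw [Finset.filter_erase, Finset.card_erase_add_one]; simp [hi, h]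
  · rw [Finset.filter_erase, Finset.erase_eq_of_notMem]; simp [h.le]

theorem d_d (α : Cochain x) : d x (d x α) = 0 := by
  funext s
  rw [d_apply]
  simp only [d_apply, map_sum, map_smul, res_res, Finset.smul_sum, smul_smul]
  rw [Finset.sum_sigma']
  refine Finset.sum_involution (fun a _ => ⟨a.2, a.1⟩) ?_ ?_ ?_ ?_
  · rintro ⟨j, i⟩ h
    simp only [Finset.mem_sigma, Finset.mem_erase] at h
    obtain ⟨hj, hij, hi⟩ := h
    simp only
    rw [res_congr x (Finset.erase_right_comm (a := i) (b := j) (s := s)) _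
      (((Finset.erase_subset _ _).trans (Finset.erase_subset _ _))), ← add_smul]
    convert zero_smul A _
    rcases lt_or_gt_of_ne hij with h | h
    · obtain ⟨h1, h2⟩ := card_aux hi h
      rw [h1, h2]; ring
    · obtain ⟨h1, h2⟩ := card_aux hj h
      rw [h1, h2]; ring
  · rintro ⟨j, i⟩ h _ he
    simp only [Finset.mem_sigma, Finset.mem_erase] at h
    exact h.2.1 (by simpa using congrArg Sigma.fst he)
  · rintro ⟨j, i⟩ h
    simp only [Finset.mem_sigma, Finset.mem_erase] at h ⊢
    exact ⟨h.2.2, h.2.1.symm, h.1⟩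
  · rintro ⟨j, i⟩ h
    rfl
/-- The cochains supported on the subsets whose cardinality satisfies `P`. -/
def supportedOn (P : ℕ → Prop) : Submodule A (Cochain x) where
  carrier := {α | ∀ s, ¬ P s.card → α s = 0}
  add_mem' ha hb s hs := by simp [ha s hs, hb s hs]
  zero_mem' _ _ := rfl
  smul_mem' r _ ha s hs := by simp [ha s hs]

/-- The `i`-cocycles: the kernel of `C^i → C^{i+1}`. -/
def cocycles (i : ℕ) : Submodule A (Cochain x) :=
  supportedOn x (fun m => m = i) ⊓ LinearMap.ker (d x)

/-- The `i`-coboundaries: the image of `C^{i-1} → C^i` (which is zero for `i = 0`). -/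
def coboundaries (i : ℕ) : Submodule A (Cochain x) :=
  (supportedOn x (fun m => m + 1 = i)).map (d x)

/-- The `i`-th Čech cohomology module of `A` with respect to `x_0, …, x_{N-1}`.  For Noetherian
`A` it is the `i`-th local cohomology module of `A` with support in `(x_0, …, x_{N-1})`. -/
abbrev H (i : ℕ) : Type _ := cocycles x i ⧸ (coboundaries x i).submoduleOf (cocycles x i)

section Frobenius

/-- The Frobenius endomorphism `b ↦ b ^ p` of a commutative ring in which the prime `p` is zero. -/
def frob {B : Type*} [CommRing B] (p : ℕ) [hp : Fact p.Prime] (hB : (p : B) = 0) : B →+* B where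
  toFun b := b ^ p
  map_one' := one_pow p
  map_mul' a b := mul_pow a b p
  map_zero' := zero_pow hp.out.ne_zero
  map_add' a b := by
    obtain ⟨r, hr⟩ := exists_add_pow_prime_eq hp.out a b
    simp [hr, hB]

theorem loc_natCast_eq_zero (p : ℕ) (hA : (p : A) = 0) (s : Finset (Fin N)) :
    (p : Loc x s) = 0 := by
  rw [← map_natCast (algebraMap A (Loc x s)), hA, map_zero]

/-- The Frobenius map on cochains, acting on every localization `A_{x_s}` by its Frobenius. -/
def frobCochain (p : ℕ) [Fact p.Prime] (hA : (p : A) = 0) : Cochain x →+ Cochain x where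
  toFun α := fun s => frob p (loc_natCast_eq_zero x p hA s) (α s)
  map_zero' := by
    funext s
    simp
  map_add' α β := by
    funext s
    simp

variable (p : ℕ) [hp : Fact p.Prime] (hA : (p : A) = 0)

theorem d_frobCochain (α : Cochain x) :
    d x (frobCochain x p hA α) = frobCochain x p hA (d x α) := by
  funext s
  have hsign (e : ℕ) : ((-1 : A) ^ e) ^ p = (-1) ^ e := by
    change frob p hA ((-1) ^ e) = (-1) ^ e
    simp
  have h1 : frobCochain x p hA (d x α) s =
      frob p (loc_natCast_eq_zero x p hA s) (d x α s) := rfl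
  rw [h1]
  simp only [d, LinearMap.pi_apply, LinearMap.sum_apply, map_sum]
  refine Finset.sum_congr rfl fun j _ => ?_
  simp only [LinearMap.smul_apply, LinearMap.comp_apply, LinearMap.proj_apply,
    AlgHom.toLinearMap_apply, frobCochain, frob, RingHom.coe_mk, MonoidHom.coe_mk, OneHom.coe_mk,
    AddMonoidHom.coe_mk, ZeroHom.coe_mk, map_pow, smul_pow, hsign]

theorem frobCochain_mem_supportedOn (P : ℕ → Prop) {α : Cochain x} (h : α ∈ supportedOn x P) :
    frobCochain x p hA α ∈ supportedOn x P := by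
  intro s hs
  simp [frobCochain, h s hs]

/-- The Frobenius map on `i`-cocycles. -/
def frobCocycles (i : ℕ) : cocycles x i →+ cocycles x i :=
  ((frobCochain x p hA).comp (cocycles x i).subtype.toAddMonoidHom).codRestrict (cocycles x i)
    fun α => by
      refine ⟨frobCochain_mem_supportedOn x p hA _ α.2.1, ?_⟩
      have h : d x (α : Cochain x) = 0 := α.2.2
      change d x (frobCochain x p hA α) = 0
      rw [d_frobCochain, h, map_zero]

/-- The Frobenius action on Čech cohomology, induced by the Frobenius map on cochains. -/
def frobenius (i : ℕ) : H x i →+ H x i :=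
  QuotientAddGroup.map ((coboundaries x i).submoduleOf (cocycles x i)).toAddSubgroup
    ((coboundaries x i).submoduleOf (cocycles x i)).toAddSubgroup (frobCocycles x p hA i) (by
      rintro α ⟨β, hβ, h⟩
      refine ⟨frobCochain x p hA β, frobCochain_mem_supportedOn x p hA _ hβ, ?_⟩
      rw [d_frobCochain, h]
      rfl)

end Frobenius

end Cech

/-! ### Graded quotients of a polynomial ring -/

namespace Graded

open MvPolynomial

variable {k : Type*} [Field k] {n : ℕ}

/-- The irrelevant ideal `𝔪 = (x_0, …, x_n)`. -/
def irrelevant (k : Type*) [Field k] (n : ℕ) : Ideal (MvPolynomial (Fin (n + 1)) k) :=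
  Ideal.span (Set.range X)

/-- The degree `t` part of `k[x_0, …, x_n]` for the standard grading, indexed by all integers. -/
abbrev polyDeg (k : Type*) [Field k] (n : ℕ) (t : ℤ) : Submodule k (MvPolynomial (Fin (n + 1)) k) :=
  weightedHomogeneousSubmodule k (fun _ => (1 : ℤ)) t

variable (I : Ideal (MvPolynomial (Fin (n + 1)) k))

/-- The degree `t` part of `S/I`: the classes of the homogeneous polynomials of degree `t`.
(For homogeneous `I` these pieces are the standard grading of `S/I`.) -/
def quotDeg (t : ℤ) : AddSubgroup (MvPolynomial (Fin (n + 1)) k ⧸ I) :=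
  (polyDeg k n t).toAddSubgroup.map (Ideal.Quotient.mk I).toAddMonoidHom

/-- The classes of the variables in `S/I`. -/
def xbar (j : Fin (n + 1)) : MvPolynomial (Fin (n + 1)) k ⧸ I := Ideal.Quotient.mk I (X j)

theorem mul_mem_quotDeg {t u : ℤ} {a b : MvPolynomial (Fin (n + 1)) k ⧸ I}
    (ha : a ∈ quotDeg I t) (hb : b ∈ quotDeg I u) : a * b ∈ quotDeg I (t + u) := by
  obtain ⟨g, hg, rfl⟩ := ha
  obtain ⟨h, hh, rfl⟩ := hb
  exact ⟨g * h, IsWeightedHomogeneous.mul hg hh, map_mul (Ideal.Quotient.mk I) g h⟩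

theorem prod_xbar_pow_mem (s : Finset (Fin (n + 1))) (m : ℕ) :
    (∏ j ∈ s, xbar I j) ^ m ∈ quotDeg I (m * s.card) := by
  refine ⟨(∏ j ∈ s, X j) ^ m, ?_, by simp [xbar]⟩
  have h := (IsWeightedHomogeneous.prod (R := k) s X (fun _ => (1 : ℤ))
    (w := fun _ : Fin (n + 1) => (1 : ℤ)) fun i _ => isWeightedHomogeneous_X k _ i).pow m
  simpa using h

/-- The degree `t` part of the localization `(S/I)_{x_s}`: the fractions `a / x_s ^ m` with `a`
homogeneous of degree `t + m * #s`. -/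
def locDeg (s : Finset (Fin (n + 1))) (t : ℤ) : AddSubgroup (Cech.Loc (xbar I) s) where
  carrier := {z | ∃ m : ℕ, ∃ a ∈ quotDeg I (t + m * s.card),
    z * algebraMap _ (Cech.Loc (xbar I) s) (∏ j ∈ s, xbar I j) ^ m = algebraMap _ _ a}
  zero_mem' := ⟨0, 0, zero_mem _, by simp⟩
  neg_mem' := by
    rintro z ⟨m, a, ha, h⟩
    exact ⟨m, -a, neg_mem ha, by rw [map_neg, ← h, neg_mul]⟩
  add_mem' := by
    rintro z w ⟨m, a, ha, hz⟩ ⟨l, b, hb, hw⟩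
    refine ⟨m + l, a * (∏ j ∈ s, xbar I j) ^ l + b * (∏ j ∈ s, xbar I j) ^ m, add_mem ?_ ?_, ?_⟩
    · have := mul_mem_quotDeg I ha (prod_xbar_pow_mem I s l)
      convert this using 2
      push_cast
      ring
    · have := mul_mem_quotDeg I hb (prod_xbar_pow_mem I s m)
      convert this using 2
      push_cast
      ring
    · rw [map_add, map_mul, map_mul, ← hz, ← hw, map_pow, map_pow]
      ring

/-- The local cohomology `H^i_𝔪(S/I)`, computed by the Čech complex on `x_0, …, x_n`. -/
abbrev LC (i : ℕ) : Type _ := Cech.H (xbar I) i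

/-- The degree `t` part `H^i_𝔪(S/I)_t`: the classes of the cocycles all of whose components are
homogeneous of degree `t`. -/
def lcDeg (i : ℕ) (t : ℤ) : AddSubgroup (LC I i) :=
  ((AddSubgroup.pi Set.univ fun s => locDeg I s t).comap
    (Cech.cocycles (xbar I) i).subtype.toAddMonoidHom).map
      ((Cech.coboundaries (xbar I) i).submoduleOf (Cech.cocycles (xbar I) i)).mkQ.toAddMonoidHom

/-- `H^i_𝔪(S/I)_{< b}`, the sum of the graded pieces of degree less than `b`. -/
def lcBelow (i : ℕ) (b : ℤ) : AddSubgroup (LC I i) :=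
  ⨆ (t : ℤ) (_ : t < b), lcDeg I i t

theorem quot_natCast_eq_zero (p : ℕ) [CharP k p] :
    (p : MvPolynomial (Fin (n + 1)) k ⧸ I) = 0 := by
  rw [← map_natCast (Ideal.Quotient.mk I), ← map_natCast (C (σ := Fin (n + 1)) (R := k)),
    CharP.cast_eq_zero, map_zero, map_zero]

/-- The Frobenius action on `H^i_𝔪(S/I)`. -/
def lcFrob (p : ℕ) [Fact p.Prime] [CharP k p] (i : ℕ) : LC I i →+ LC I i :=
  Cech.frobenius (xbar I) p (quot_natCast_eq_zero I p) i

/-- `reg M = max {t | M_t ≠ 0}` for a graded module `M` with graded pieces `𝓜 t`, vanishing in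
large degrees. -/
def reg {M : Type*} [AddGroup M] (𝓜 : ℤ → AddSubgroup M) : ℤ := sSup {t | 𝓜 t ≠ ⊥}

/-- The Krull dimension of `S/I` as a natural number (for proper `I`). -/
def dim : ℕ := ((ringKrullDim (MvPolynomial (Fin (n + 1)) k ⧸ I)).unbotD 0).toNat

/-- The a-invariant `a(A) = reg (H^{dim A}_𝔪(A))` of `A = S/I`. -/
def aInvariant : ℤ := reg (lcDeg I (dim I))

/-- The Frobenius power `I^{[p]} = (a ^ p | a ∈ I)`. -/
def frobPower {S : Type*} [CommRing S] (p : ℕ) (I : Ideal S) : Ideal S :=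
  Ideal.span {b | ∃ a ∈ I, b = a ^ p}

end Graded

end

/-! ### Čech complexes: supports, localizations and multiplication by ring elements. -/

noncomputable section

namespace Cech

section Support

variable {A : Type*} [CommRing A] {N : ℕ} {x : Fin N → A}

/-! Local duality makes the kernel of Frobenius explicit. Write `F` for the product of the `f_i` and
`a` for `a(R)`.

The top local cohomology of `S` consists of inverse polynomials, which the residue (the coefficient
of `(x_0 ⋯ x_n)⁻¹`) identifies with functionals on `S` of finite support. Laurent exponents with a
nonnegative coordinate contribute nothing, because the Čech complex in such a multidegree is
contractible (`mem_coboundaries_of_cochainCoeff`).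

The `f_i` are then divided out one at a time. Cohomology below the top degree vanishes, so the
connecting homomorphism of `0 → A → A → A/f → 0` is injective. The composite of these maps
identifies `H^{n+1-c}(R)` with the finitely supported functionals that vanish on `J`, and a class of
degree `t` becomes a functional living on `S_{a-t}`. If `β` lifts `α` and `dβ = f γ`, then `d(β^p) =
f · (f^{p-1} γ^p)`. Hence Frobenius on `R` becomes Frobenius on functionals followed by
multiplication by `F^{p-1}`. `ResiduePairing` records this dictionary, and
`ResiduePairing.nonempty_quotient` is the inductive step.

Frobenius on functionals is adjoint to the Cartier maps on `S` (`apply_frobDual_mul_monomial`).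
Therefore `F^{p-1}` annihilates the Frobenius twist of `θ` exactly when `θ` vanishes on the ideal
generated by the Cartier images of `F^{p-1}`, which is the smallest `I` with `F^{p-1} ∈ I^{[p]}`. So
`τ` is the sum of `J` and this ideal, and the kernel of Frobenius is the graded dual of `S/τ`, with
the dual of `(S/τ)_D` placed in degree `a - D`. The lowest degree of the kernel is thus `a -
reg(S/τ)`, which gives injectivity below this degree and sharpness at once. -/

theorem d_mem_supportedOn {i : ℕ} {α : Cochain x} (h : α ∈ supportedOn x (fun m => m = i)) :
    d x α ∈ supportedOn x (fun m => m = i + 1) := by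
  intro s hs
  rw [d_apply]
  refine Finset.sum_eq_zero fun j hj => ?_
  rw [h (s.erase j), map_zero, smul_zero]
  rw [Finset.card_erase_of_mem hj]
  have := Finset.card_pos.mpr ⟨j, hj⟩
  simp only at hs ⊢
  omega

theorem mem_cocycles {i : ℕ} {α : Cochain x} :
    α ∈ cocycles x i ↔ α ∈ supportedOn x (fun m => m = i) ∧ d x α = 0 := Iff.rfl

theorem d_mem_coboundaries {i : ℕ} {α : Cochain x}
    (h : α ∈ supportedOn x (fun m => m = i)) : d x α ∈ coboundaries x (i + 1) :=
  ⟨α, fun s hs => h s (by simpa using hs), rfl⟩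

theorem mem_coboundaries_succ {i : ℕ} {α : Cochain x} :
    α ∈ coboundaries x (i + 1) ↔ ∃ β ∈ supportedOn x (fun m => m = i), d x β = α := by
  simp [coboundaries]

theorem coboundaries_le_cocycles (i : ℕ) : coboundaries x i ≤ cocycles x i := by
  rintro _ ⟨β, hβ, rfl⟩
  refine ⟨?_, d_d x β⟩
  cases i with
  | zero =>
    have : β = 0 := funext fun s => hβ s (by simp)
    simp [this]
  | succ i => exact d_mem_supportedOn fun s hs => hβ s (by simpa using hs)

theorem exists_loc (s : Finset (Fin N)) (z : Loc x s) :
    ∃ (m : ℕ) (a : A), z * algebraMap A (Loc x s) (∏ j ∈ s, x j) ^ m =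
        algebraMap A (Loc x s) a := by
  obtain ⟨m, a, h⟩ := IsLocalization.Away.surj (∏ j ∈ s, x j) z
  exact ⟨m, a, by simpa using h⟩

theorem isUnit_prod (s : Finset (Fin N)) :
    IsUnit (algebraMap A (Loc x s) (∏ j ∈ s, x j)) :=
  IsLocalization.Away.algebraMap_isUnit _

theorem algebraMap_eq_zero_iff (s : Finset (Fin N)) (a : A) :
    algebraMap A (Loc x s) a = 0 ↔ ∃ m : ℕ, (∏ j ∈ s, x j) ^ m * a = 0 := by
  rw [IsLocalization.map_eq_zero_iff (Submonoid.powers (∏ j ∈ s, x j)) (Loc x s)]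
  constructor
  · rintro ⟨⟨_, m, rfl⟩, h⟩; exact ⟨m, h⟩
  · rintro ⟨m, h⟩; exact ⟨⟨_, m, rfl⟩, h⟩

theorem res_algebraMap {s t : Finset (Fin N)} (h : s ⊆ t) (a : A) :
    res x h (algebraMap A (Loc x s) a) = algebraMap A (Loc x t) a :=
  (res x h).commutes a

theorem smul_loc_eq_zero {f : A} (hf : ∀ a, f * a = 0 → a = 0) {s : Finset (Fin N)} {z : Loc x s}
    (h : f • z = 0) : z = 0 := by
  obtain ⟨m, a, ha⟩ := exists_loc s z
  have h1 : algebraMap A (Loc x s) (f * a) = 0 := by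
    rw [map_mul, ← ha, ← mul_assoc, ← Algebra.smul_def, h, zero_mul]
  obtain ⟨l, hl⟩ := (algebraMap_eq_zero_iff s _).mp h1
  have h2 : algebraMap A (Loc x s) a = 0 :=
    (algebraMap_eq_zero_iff s _).mpr ⟨l, hf _ (by rw [← hl]; ring)⟩
  rw [h2] at ha
  exact ((isUnit_prod s).pow m).mul_left_eq_zero.mp ha

/-- Multiplication of a cochain by a ring element. -/
def scale (a : A) (α : Cochain x) : Cochain x := a • α

theorem scale_def (a : A) (α : Cochain x) : scale a α = a • α := rfl

theorem scale_apply (a : A) (α : Cochain x) (s : Finset (Fin N)) :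
    scale a α s = algebraMap A (Loc x s) a * α s := by
  rw [scale_def, Pi.smul_apply, Algebra.smul_def]

theorem scale_mem {a : A} {α : Cochain x} {M : Submodule A (Cochain x)} (h : α ∈ M) :
    scale a α ∈ M := M.smul_mem a h

theorem scale_add (a : A) (α β : Cochain x) : scale a (α + β) = scale a α + scale a β :=
  smul_add a α β

theorem d_scale (a : A) (α : Cochain x) : d x (scale a α) = scale a (d x α) :=
  map_smul (d x) a α

theorem scale_scale (a b : A) (α : Cochain x) : scale a (scale b α) = scale (a * b) α :=
  smul_smul a b α

theorem zero_scale (α : Cochain x) : scale 0 α = 0 := zero_smul A α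

/-- Multiplication of a cocycle by a ring element. -/
def scaleCocycle {i : ℕ} (a : A) (α : cocycles x i) : cocycles x i :=
  ⟨scale a α.1, scale_mem α.2⟩

/-- Used for the projections to a fixed degree. Since `T` is only additive, the signs are treated as
`1` or `-1`. -/
theorem d_map_of_res (T : ∀ s, Loc x s →+ Loc x s)
    (hT : ∀ {s t : Finset (Fin N)} (h : s ⊆ t) z, T t (res x h z) = res x h (T s z))
    (α : Cochain x) : (fun s => T s (d x α s)) = d x (fun s => T s (α s)) := by
  funext s
  rw [d_apply, d_apply, map_sum]
  refine Finset.sum_congr rfl fun j _ => ?_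
  rw [← hT]
  rcases neg_one_pow_eq_or A (s.filter (· < j)).card with h | h <;> simp [h]

theorem scale_injective {f : A} (hf : ∀ a, f * a = 0 → a = 0) {γ γ' : Cochain x}
    (h : scale f γ = scale f γ') : γ = γ' := by
  rw [← sub_eq_zero] at h ⊢
  rw [scale_def, scale_def, ← smul_sub] at h
  exact funext fun s => smul_loc_eq_zero hf (congrFun h s)

end Support

/-! ### Change of rings and the connecting homomorphism of multiplication by a nonzerodivisor. -/

section BaseChange

variable {A B : Type*} [CommRing A] [CommRing B] {N : ℕ} {x : Fin N → A} {y : Fin N → B}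

theorem map_prod_eq (φ : A →+* B) (hφ : ∀ j, φ (x j) = y j) (s : Finset (Fin N)) :
    φ (∏ j ∈ s, x j) = ∏ j ∈ s, y j := by
  simp [map_prod, hφ]

variable (φ : A →+* B) (hφ : ∀ j, φ (x j) = y j)

/-- The map `A_{x_s} → B_{y_s}` induced by a ring homomorphism `A → B` with `x_j ↦ y_j`. -/
def mapLoc (s : Finset (Fin N)) : Loc x s →+* Loc y s :=
  IsLocalization.map (M := Submonoid.powers (∏ j ∈ s, x j))
    (T := Submonoid.powers (∏ j ∈ s, y j)) (Loc y s) φ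
    (by rintro _ ⟨m, rfl⟩; exact ⟨m, by simp [map_prod_eq φ hφ s]⟩)

@[simp]
theorem mapLoc_algebraMap (s : Finset (Fin N)) (a : A) :
    mapLoc φ hφ s (algebraMap A (Loc x s) a) = algebraMap B (Loc y s) (φ a) :=
  IsLocalization.map_eq _ a

theorem mapLoc_res {s t : Finset (Fin N)} (h : s ⊆ t) (z : Loc x s) :
    mapLoc φ hφ t (res x h z) = res y h (mapLoc φ hφ s z) := by
  have : (mapLoc φ hφ t).comp (res x h : Loc x s →+* Loc x t) =
      (res y h : Loc y s →+* Loc y t).comp (mapLoc φ hφ s) := by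
    refine IsLocalization.ringHom_ext (Submonoid.powers (∏ j ∈ s, x j)) ?_
    ext a
    simp
  exact DFunLike.congr_fun this z

theorem mapLoc_smul (s : Finset (Fin N)) (a : A) (z : Loc x s) :
    mapLoc φ hφ s (a • z) = φ a • mapLoc φ hφ s z := by
  simp [Algebra.smul_def]

theorem mapLoc_mul_pow (s : Finset (Fin N)) (z : Loc x s) {m : ℕ} {a : A}
    (h : z * algebraMap A (Loc x s) (∏ j ∈ s, x j) ^ m = algebraMap A (Loc x s) a) :
    mapLoc φ hφ s z * algebraMap B (Loc y s) (∏ j ∈ s, y j) ^ m =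
      algebraMap B (Loc y s) (φ a) := by
  rw [← mapLoc_algebraMap φ hφ, ← h, map_mul, map_pow, mapLoc_algebraMap, map_prod_eq φ hφ]

theorem mapLoc_surjective (hsurj : Function.Surjective φ) (s : Finset (Fin N)) :
    Function.Surjective (mapLoc φ hφ s) := by
  intro z
  obtain ⟨m, b, hb⟩ := exists_loc s z
  obtain ⟨a, rfl⟩ := hsurj b
  refine ⟨IsLocalization.mk' _ a (⟨_, m, rfl⟩ : Submonoid.powers (∏ j ∈ s, x j)), ?_⟩
  refine ((isUnit_prod (x := y) s).pow m).mul_left_injective ?_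
  change _ * _ = _ * _
  rw [hb]
  refine mapLoc_mul_pow φ hφ s _ ?_
  have := IsLocalization.mk'_spec (Loc x s) a (⟨_, m, rfl⟩ : Submonoid.powers (∏ j ∈ s, x j))
  simpa using this

/-- Exactness of localization: the numerator of `z` lies in `f A` after multiplication by a power of
`x_s`, and that power is absorbed into the denominator. -/
theorem exists_smul_of_mapLoc_eq_zero {f : A} (hker : ∀ a, φ a = 0 → ∃ b, a = f * b)
    {s : Finset (Fin N)} {z : Loc x s} (hz : mapLoc φ hφ s z = 0) : ∃ w : Loc x s, z = f • w := by
  obtain ⟨m, a, ha⟩ := exists_loc s z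
  have h := mapLoc_mul_pow φ hφ s z ha
  rw [hz, zero_mul] at h
  obtain ⟨l, hl⟩ := (algebraMap_eq_zero_iff s _).mp h.symm
  rw [← map_prod_eq φ hφ, ← map_pow, ← map_mul] at hl
  obtain ⟨b, hb⟩ := hker _ hl
  refine ⟨IsLocalization.mk' _ b (⟨_, l + m, rfl⟩ : Submonoid.powers (∏ j ∈ s, x j)), ?_⟩
  refine ((isUnit_prod (x := x) s).pow (l + m)).mul_left_injective ?_
  change _ * _ = _ * _
  have h2 := IsLocalization.mk'_spec (Loc x s) b
    (⟨_, l + m, rfl⟩ : Submonoid.powers (∏ j ∈ s, x j))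
  simp only [map_pow] at h2
  rw [smul_mul_assoc, h2, Algebra.smul_def, ← map_mul, ← hb, map_mul, ← ha, map_pow, pow_add]
  ring

/-- The cochain map induced by a ring homomorphism `A → B` with `x_j ↦ y_j`. -/
def mapCochain : Cochain x →+ Cochain y where
  toFun α := fun s => mapLoc φ hφ s (α s)
  map_zero' := by funext s; simp
  map_add' α β := by funext s; simp

theorem mapCochain_apply (α : Cochain x) (s : Finset (Fin N)) :
    mapCochain φ hφ α s = mapLoc φ hφ s (α s) := rfl

theorem mapCochain_smul (a : A) (α : Cochain x) :
    mapCochain φ hφ (a • α) = φ a • mapCochain φ hφ α :=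
  funext fun s => mapLoc_smul φ hφ s a (α s)

theorem mapCochain_scale (a : A) (α : Cochain x) :
    mapCochain φ hφ (scale a α) = scale (φ a) (mapCochain φ hφ α) :=
  mapCochain_smul φ hφ a α

theorem mapCochain_d (α : Cochain x) :
    mapCochain φ hφ (d x α) = d y (mapCochain φ hφ α) := by
  funext s
  simp only [mapCochain_apply, d_apply, map_sum, mapLoc_smul, mapLoc_res, map_pow, map_neg,
    map_one]

theorem mapCochain_mem_supportedOn {P : ℕ → Prop} {α : Cochain x} (h : α ∈ supportedOn x P) :
    mapCochain φ hφ α ∈ supportedOn y P := fun s hs => by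
  rw [mapCochain_apply, h s hs, map_zero]

theorem exists_mapCochain_eq (hsurj : Function.Surjective φ) {P : ℕ → Prop} {α : Cochain y}
    (h : α ∈ supportedOn y P) : ∃ β ∈ supportedOn x P, mapCochain φ hφ β = α := by
  classical
  choose z hz using fun s => mapLoc_surjective φ hφ hsurj s (α s)
  -- The lifts are chosen independently on each subset, so they are cut off to keep the support.
  refine ⟨fun s => if P s.card then z s else 0, fun s hs => if_neg hs, funext fun s => ?_⟩
  rw [mapCochain_apply]
  split_ifs with hs
  · exact hz s
  · rw [map_zero, h s hs]

theorem exists_smul_of_mapCochain_eq_zero {f : A} (hker : ∀ a, φ a = 0 → ∃ b, a = f * b)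
    {P : ℕ → Prop} {β : Cochain x} (h : β ∈ supportedOn x P) (hβ : mapCochain φ hφ β = 0) :
    ∃ γ ∈ supportedOn x P, β = f • γ := by
  classical
  choose z hz using fun s => exists_smul_of_mapLoc_eq_zero φ hφ hker (congrFun hβ s)
  refine ⟨fun s => if P s.card then z s else 0, fun s hs => if_neg hs, funext fun s => ?_⟩
  rw [Pi.smul_apply]
  split_ifs with hs
  · exact hz s
  · rw [smul_zero, h s hs]

theorem mapCochain_frobCochain (p : ℕ) [Fact p.Prime] (hA : (p : A) = 0) (hB : (p : B) = 0)
    (α : Cochain x) :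
    mapCochain φ hφ (frobCochain x p hA α) = frobCochain y p hB (mapCochain φ hφ α) :=
  funext fun s => map_pow (mapLoc φ hφ s) (α s) p

theorem frobCochain_smul (p : ℕ) [Fact p.Prime] (hA : (p : A) = 0) (a : A) (α : Cochain x) :
    frobCochain x p hA (a • α) = a ^ p • frobCochain x p hA α :=
  funext fun s => smul_pow a (α s) p

/-- The graph of the connecting homomorphism of `0 → A → A → B → 0`, where the first map is
multiplication by `f`: the cochain `γ` is related to the cocycle `α` if `f γ` is the differential
of a lift of `α`. -/
def Connecting (f : A) (i : ℕ) (α : Cochain y) (γ : Cochain x) : Prop :=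
  ∃ β ∈ supportedOn x (fun m => m = i), mapCochain φ hφ β = α ∧ d x β = scale f γ

namespace Connecting

variable {φ hφ} {f : A} {i : ℕ} {α α' : Cochain y} {γ γ' : Cochain x}

theorem add (h : Connecting φ hφ f i α γ) (h' : Connecting φ hφ f i α' γ') :
    Connecting φ hφ f i (α + α') (γ + γ') := by
  obtain ⟨β, hβ, rfl, e⟩ := h
  obtain ⟨β', hβ', rfl, e'⟩ := h'
  exact ⟨β + β', add_mem hβ hβ', map_add _ _ _, by rw [map_add, e, e', scale_add]⟩

theorem smul (a : A) (h : Connecting φ hφ f i α γ) :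
    Connecting φ hφ f i (scale (φ a) α) (scale a γ) := by
  obtain ⟨β, hβ, rfl, e⟩ := h
  exact ⟨a • β, Submodule.smul_mem _ a hβ, mapCochain_smul _ _ _ _,
    by rw [← scale_def, d_scale, e, scale_scale, scale_scale, mul_comm]⟩

theorem neg (h : Connecting φ hφ f i α γ) : Connecting φ hφ f i (-α) (-γ) := by
  simpa [scale_def] using h.smul (-1)

theorem sub (h : Connecting φ hφ f i α γ) (h' : Connecting φ hφ f i α' γ') :
    Connecting φ hφ f i (α - α') (γ - γ') := by
  simpa [sub_eq_add_neg] using h.add h'.neg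

/-- If `β` lifts `α`, then `β^p` lifts `α^p`, and `d(β^p) = (f γ)^p = f · (f^{p-1} γ^p)`. This is
the source of the factor `F^{p-1}`. -/
theorem frob {p : ℕ} [Fact p.Prime] {hA : (p : A) = 0} {hB : (p : B) = 0}
    (h : Connecting φ hφ f i α γ) :
    Connecting φ hφ f i (frobCochain y p hB α) (scale (f ^ (p - 1)) (frobCochain x p hA γ)) := by
  obtain ⟨β, hβ, rfl, e⟩ := h
  refine ⟨frobCochain x p hA β, frobCochain_mem_supportedOn x p hA _ hβ,
    mapCochain_frobCochain φ hφ p hA hB β, ?_⟩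
  rw [d_frobCochain, e, scale_def, frobCochain_smul, scale_scale, ← scale_def,
      mul_pow_sub_one (Fact.out : p.Prime).ne_zero]

theorem exists_of_cocycle (hsurj : Function.Surjective φ)
    (hker : ∀ a, φ a = 0 → ∃ b, a = f * b) (hα : α ∈ cocycles y i) :
    ∃ γ, Connecting φ hφ f i α γ := by
  obtain ⟨β, hβ, rfl⟩ := exists_mapCochain_eq φ hφ hsurj hα.1
  have h : mapCochain φ hφ (d x β) = 0 := by rw [mapCochain_d]; exact hα.2
  obtain ⟨γ, -, hγ⟩ := exists_smul_of_mapCochain_eq_zero φ hφ hker (d_mem_supportedOn hβ) h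
  exact ⟨γ, β, hβ, rfl, hγ⟩

theorem mem_cocycles (hreg : ∀ a, f * a = 0 → a = 0) (h : Connecting φ hφ f i α γ) :
    γ ∈ cocycles x (i + 1) := by
  obtain ⟨β, hβ, rfl, e⟩ := h
  constructor
  · intro s hs
    refine smul_loc_eq_zero hreg ?_
    rw [← Pi.smul_apply f γ s, ← scale_def, ← e]
    exact d_mem_supportedOn hβ s hs
  · refine scale_injective hreg (f := f) ?_
    rw [← d_scale, ← e, d_d, scale_def, smul_zero]

theorem mem_coboundaries_of_zero (hker : ∀ a, φ a = 0 → ∃ b, a = f * b)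
    (hreg : ∀ a, f * a = 0 → a = 0) (h : Connecting φ hφ f i 0 γ) :
    γ ∈ coboundaries x (i + 1) := by
  obtain ⟨β, hβ, h0, e⟩ := h
  obtain ⟨η, hη, rfl⟩ := exists_smul_of_mapCochain_eq_zero φ hφ hker hβ h0
  have : d x η = γ := scale_injective hreg (by rw [← e, ← scale_def, d_scale])
  exact this ▸ d_mem_coboundaries hη

/-- Well-definedness on classes: the coboundary `α` also has the lift `dβ` with differential zero,
so subtracting reduces to `α = 0`. -/
theorem mem_coboundaries (hsurj : Function.Surjective φ)
    (hker : ∀ a, φ a = 0 → ∃ b, a = f * b) (hreg : ∀ a, f * a = 0 → a = 0)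
    (h : Connecting φ hφ f i α γ) (hα : α ∈ coboundaries y i) : γ ∈ coboundaries x (i + 1) := by
  obtain ⟨η, hη, rfl⟩ := hα
  obtain ⟨β, hβ, rfl⟩ := exists_mapCochain_eq φ hφ hsurj hη
  have h' : Connecting φ hφ f i (d y (mapCochain φ hφ β)) 0 :=
    ⟨d x β, (coboundaries_le_cocycles i ⟨β, hβ, rfl⟩).1, mapCochain_d φ hφ β,
      by rw [d_d, scale_def, smul_zero]⟩
  have := h.sub h'
  rw [sub_self, sub_zero] at this
  exact this.mem_coboundaries_of_zero hker hreg

/-- Injectivity on classes: if `γ = dη`, then `β - f η` is a cocycle that still lifts `α`, and it is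
a coboundary by the vanishing of the `i`-th cohomology of `A`. -/
theorem coboundary_of (hφf : φ f = 0) (hvan : cocycles x i ≤ coboundaries x i)
    (h : Connecting φ hφ f i α γ) (hγ : γ ∈ coboundaries x (i + 1)) : α ∈ coboundaries y i := by
  obtain ⟨β, hβ, rfl, e⟩ := h
  obtain ⟨η, hη, rfl⟩ := mem_coboundaries_succ.mp hγ
  have h1 : β - f • η ∈ cocycles x i :=
    ⟨sub_mem hβ (Submodule.smul_mem _ f hη), by
      change d x (β - f • η) = 0
      rw [map_sub, e, ← scale_def, d_scale, sub_self]⟩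
  obtain ⟨ζ, hζ, e'⟩ := hvan h1
  refine ⟨mapCochain φ hφ ζ, mapCochain_mem_supportedOn φ hφ hζ, ?_⟩
  rw [← mapCochain_d, e', map_sub, mapCochain_smul, hφf, zero_smul, sub_zero]

end Connecting

/-- Vanishing of Čech cohomology passes to the quotient by a nonzerodivisor, with a shift. -/
theorem cocycles_le_coboundaries_of_quotient (φ : A →+* B) (hφ : ∀ j, φ (x j) = y j) {f : A} {i : ℕ}
    (hsurj : Function.Surjective φ)
    (hφf : φ f = 0) (hker : ∀ a, φ a = 0 → ∃ b, a = f * b) (hreg : ∀ a, f * a = 0 → a = 0)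
    (h₀ : cocycles x i ≤ coboundaries x i) (h₁ : cocycles x (i + 1) ≤ coboundaries x (i + 1)) :
    cocycles y i ≤ coboundaries y i := fun α hα => by
  obtain ⟨γ, hγ⟩ := Connecting.exists_of_cocycle (hφ := hφ) hsurj hker hα
  exact hγ.coboundary_of hφf h₀ (h₁ (hγ.mem_cocycles hreg))

/-- The graph of the connecting homomorphism on cocycles. -/
def Connects (φ : A →+* B) (hφ : ∀ j, φ (x j) = y j) (f : A) (i : ℕ) (α : cocycles y i)
    (γ : cocycles x (i + 1)) : Prop := Connecting φ hφ f i α.1 γ.1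

variable {φ hφ} in
theorem Connects.scale {f : A} {i : ℕ} {α : cocycles y i} {γ : cocycles x (i + 1)}
    (h : Connects φ hφ f i α γ) (a : A) :
    Connects φ hφ f i (scaleCocycle (φ a) α) (scaleCocycle a γ) := h.smul a

variable {φ hφ} in
theorem Connects.frob {p : ℕ} [Fact p.Prime] {hA : (p : A) = 0} {hB : (p : B) = 0}
    {f : A} {i : ℕ} {α : cocycles y i} {γ : cocycles x (i + 1)} (h : Connects φ hφ f i α γ) :
    Connects φ hφ f i (frobCocycles y p hB i α)
      (scaleCocycle (f ^ (p - 1)) (frobCocycles x p hA (i + 1) γ)) :=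
  Connecting.frob (hA := hA) (hB := hB) h

/-- A homomorphism on `(i + 1)`-cocycles of `A` whose kernel consists of the coboundaries is
transported along the connecting homomorphism to `i`-cocycles of `B = A/f`. -/
theorem exists_connects {f : A} {i : ℕ} (hsurj : Function.Surjective φ) (hφf : φ f = 0)
    (hker : ∀ a, φ a = 0 → ∃ b, a = f * b) (hreg : ∀ a, f * a = 0 → a = 0)
    (hvan : cocycles x i ≤ coboundaries x i) {M : Type*} [AddCommGroup M]
    (Δ : cocycles x (i + 1) →+ M) (hΔ : ∀ γ, Δ γ = 0 ↔ γ.1 ∈ coboundaries x (i + 1)) :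
    (∀ α, ∃ γ, Connects φ hφ f i α γ) ∧
    ∃ Δ' : cocycles y i →+ M, (∀ α γ, Connects φ hφ f i α γ → Δ' α = Δ γ) ∧
      ∀ α, Δ' α = 0 ↔ α.1 ∈ coboundaries y i := by
  have hex : ∀ α, ∃ γ, Connects φ hφ f i α γ := fun α => by
    obtain ⟨γ, hγ⟩ := Connecting.exists_of_cocycle (hφ := hφ) hsurj hker α.2
    exact ⟨⟨γ, hγ.mem_cocycles hreg⟩, hγ⟩
  choose c hc using hex
  -- Two cocycles related to the same `α` differ by a coboundary, so the choice of `c` does not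
  -- matter.
  have hD : ∀ α γ, Connects φ hφ f i α γ → Δ (c α) = Δ γ := by
    intro α γ h
    rw [← sub_eq_zero, ← map_sub, hΔ]
    have := Connecting.sub (hc α) h
    rw [sub_self] at this
    exact this.mem_coboundaries_of_zero hker hreg
  refine ⟨fun α => ⟨c α, hc α⟩, AddMonoidHom.mk' (fun α => Δ (c α)) fun α β => ?_, hD, fun α => ?_⟩
  · rw [← map_add]
    exact hD _ _ (Connecting.add (hc α) (hc β))
  · refine (hΔ _).trans ?_
    exact ⟨(hc α).coboundary_of hφf hvan, (hc α).mem_coboundaries hsurj hker hreg⟩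

end BaseChange

end Cech

end

/-! ### The grading of the Čech complex through coactions of the Laurent polynomial ring. -/

noncomputable section

namespace Graded

open MvPolynomial

variable {k : Type*} [Field k] {n : ℕ}

theorem weight_one_int (d : Fin (n + 1) →₀ ℕ) :
    Finsupp.weight (fun _ : Fin (n + 1) => (1 : ℤ)) d = d.degree := by
  simp [Finsupp.weight_apply, Finsupp.sum, Finsupp.degree_apply]

theorem mem_polyDeg {t : ℤ} {g : MvPolynomial (Fin (n + 1)) k} :
    g ∈ polyDeg k n t ↔ ∀ d, coeff d g ≠ 0 → (d.degree : ℤ) = t := by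
  rw [mem_weightedHomogeneousSubmodule]
  simp only [IsWeightedHomogeneous, weight_one_int]

theorem isHomogeneous_iff_mem_polyDeg {m : ℕ} {g : MvPolynomial (Fin (n + 1)) k} :
    g.IsHomogeneous m ↔ g ∈ polyDeg k n m := by
  rw [mem_polyDeg]
  constructor
  · intro h d hd
    exact_mod_cast h.degree_eq_sum_deg_support (mem_support_iff.mpr hd) |>.symm
  · intro h d hd
    have := h d hd
    rw [show (Finsupp.weight (1 : Fin (n + 1) → ℕ)) d = d.degree from
      (DFunLike.congr_fun Finsupp.degree_eq_weight_one d).symm]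
    exact_mod_cast this

/-- The component of degree `t : ℤ` of a polynomial. -/
abbrev comp (t : ℤ) : MvPolynomial (Fin (n + 1)) k →ₗ[k] MvPolynomial (Fin (n + 1)) k :=
  weightedHomogeneousComponent (fun _ => (1 : ℤ)) t

theorem comp_mem (t : ℤ) (g : MvPolynomial (Fin (n + 1)) k) : comp t g ∈ polyDeg k n t :=
  weightedHomogeneousComponent_isWeightedHomogeneous _ _

theorem coeff_comp (t : ℤ) (g : MvPolynomial (Fin (n + 1)) k) (d : Fin (n + 1) →₀ ℕ) :
    coeff d (comp t g) = if (d.degree : ℤ) = t then coeff d g else 0 := by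
  rw [coeff_weightedHomogeneousComponent, weight_one_int]

theorem comp_natCast (m : ℕ) (g : MvPolynomial (Fin (n + 1)) k) :
    comp m g = homogeneousComponent m g := by
  ext d
  rw [coeff_comp, coeff_homogeneousComponent]
  simp only [Nat.cast_inj]

theorem comp_of_neg {t : ℤ} (ht : t < 0) (g : MvPolynomial (Fin (n + 1)) k) : comp t g = 0 := by
  ext d
  rw [coeff_comp, if_neg (by omega), coeff_zero]

theorem comp_eq_self {t : ℤ} {g : MvPolynomial (Fin (n + 1)) k} (h : g ∈ polyDeg k n t) :
    comp t g = g := by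
  ext d
  rw [coeff_comp]
  split_ifs with hd
  · rfl
  · by_contra hne
    exact hd (mem_polyDeg.mp h d (Ne.symm hne))

theorem comp_mem_ideal {I : Ideal (MvPolynomial (Fin (n + 1)) k)}
    (hI : ∀ g ∈ I, ∀ m, homogeneousComponent m g ∈ I) {g : MvPolynomial (Fin (n + 1)) k}
    (hg : g ∈ I) (t : ℤ) : comp t g ∈ I := by
  rcases lt_or_ge t 0 with ht | ht
  · rw [comp_of_neg ht]; exact zero_mem _
  · lift t to ℕ using ht
    rw [comp_natCast]; exact hI g hg t

theorem homogeneousComponent_mem_span {s : Set (MvPolynomial (Fin (n + 1)) k)}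
    (hs : ∀ g ∈ s, ∃ m, g.IsHomogeneous m) :
    ∀ g ∈ Ideal.span s, ∀ m, homogeneousComponent m g ∈ Ideal.span s := by
  intro g hg m
  let := MvPolynomial.gradedAlgebra (σ := Fin (n + 1)) (R := k)
  have := homogeneousComponent_mem_of_mem (R := k) (I := Ideal.span s)
    (Ideal.homogeneous_span (homogeneousSubmodule (Fin (n + 1)) k) s hs) hg m
  exact this

theorem mk_mem_quotDeg {I : Ideal (MvPolynomial (Fin (n + 1)) k)} {t : ℤ}
    {g : MvPolynomial (Fin (n + 1)) k} (h : g ∈ polyDeg k n t) :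
    Ideal.Quotient.mk I g ∈ quotDeg I t := ⟨g, h, rfl⟩

variable (I : Ideal (MvPolynomial (Fin (n + 1)) k))

/-- The ring homomorphism `S → (S/I)[T, T⁻¹]` that multiplies the part of degree `t` by `T ^ t`. -/
def polyCoaction : MvPolynomial (Fin (n + 1)) k →+* LaurentPolynomial
    (MvPolynomial (Fin (n + 1)) k ⧸ I) :=
  eval₂Hom (LaurentPolynomial.C.comp ((Ideal.Quotient.mk I).comp C))
    fun j => AddMonoidAlgebra.single (1 : ℤ) (xbar I j)

theorem polyCoaction_monomial (d : Fin (n + 1) →₀ ℕ) (c : k) :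
    polyCoaction I (monomial d c) =
      AddMonoidAlgebra.single (d.degree : ℤ) (Ideal.Quotient.mk I (monomial d c)) := by
  have key : ∀ s : Finset (Fin (n + 1)), ∏ i ∈ s,
      (AddMonoidAlgebra.single (1 : ℤ) (xbar I i)) ^ d i =
      AddMonoidAlgebra.single ((∑ i ∈ s, d i : ℕ) : ℤ) (∏ i ∈ s, xbar I i ^ d i) := by
    intro s
    induction s using Finset.induction_on with
    | empty => rfl
    | insert i s hi ih =>
      rw [Finset.prod_insert hi, ih, AddMonoidAlgebra.single_pow,
        AddMonoidAlgebra.single_mul_single, Finset.prod_insert hi, Finset.sum_insert hi]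
      simp
  rw [polyCoaction, coe_eval₂Hom, eval₂_monomial, Finsupp.prod, key, monomial_eq, map_mul,
    Finsupp.prod, map_prod]
  simp only [map_pow]
  rw [RingHom.comp_apply, ← LaurentPolynomial.single_eq_C, AddMonoidAlgebra.single_mul_single,
    zero_add]
  rfl

theorem coeff_polyCoaction (t : ℤ) (g : MvPolynomial (Fin (n + 1)) k) :
    (polyCoaction I g).coeff t = Ideal.Quotient.mk I (comp t g) := by
  induction g using MvPolynomial.induction_on' with
  | monomial d c =>
    rw [polyCoaction_monomial, AddMonoidAlgebra.coeff_single, Finsupp.single_apply]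
    split_ifs with h
    · rw [comp_eq_self]
      rw [← h]
      exact isHomogeneous_iff_mem_polyDeg.mp (isHomogeneous_monomial c rfl)
    · rw [eq_comm]
      convert map_zero (Ideal.Quotient.mk I)
      ext e
      rw [coeff_comp, coeff_monomial, coeff_zero]
      split_ifs <;> grind
  | add g h hg hh => rw [map_add, map_add, map_add, ← hg, ← hh]; rfl

theorem polyCoaction_of_mem {t : ℤ} {g : MvPolynomial (Fin (n + 1)) k} (h : g ∈ polyDeg k n t) :
    polyCoaction I g = AddMonoidAlgebra.single t (Ideal.Quotient.mk I g) := by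
  ext u
  rw [coeff_polyCoaction, AddMonoidAlgebra.coeff_single, Finsupp.single_apply]
  split_ifs with hu
  · rw [← hu, comp_eq_self h]
  · convert map_zero (Ideal.Quotient.mk I)
    ext d
    rw [coeff_comp, coeff_zero]
    split_ifs with hd
    · by_contra hne
      exact hu ((mem_polyDeg.mp h d hne).symm.trans hd)
    · rfl

variable {I} (hI : ∀ g ∈ I, ∀ m, homogeneousComponent m g ∈ I)

/-- The coaction `S/I → (S/I)[T, T⁻¹]` defining the grading of `S/I` for homogeneous `I`. -/
def quotCoaction : MvPolynomial (Fin (n + 1)) k ⧸ I →+*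
    LaurentPolynomial (MvPolynomial (Fin (n + 1)) k ⧸ I) :=
  Ideal.Quotient.lift I (polyCoaction I) fun g hg => by
    ext t
    rw [coeff_polyCoaction, Ideal.Quotient.eq_zero_iff_mem.mpr (comp_mem_ideal hI hg t)]
    rfl

theorem quotCoaction_of_mem {t : ℤ} {a : MvPolynomial (Fin (n + 1)) k ⧸ I} (h : a ∈ quotDeg I t) :
    quotCoaction hI a = AddMonoidAlgebra.single t a := by
  obtain ⟨g, hg, rfl⟩ := h
  exact polyCoaction_of_mem I hg

theorem coeff_quotCoaction_mem (t : ℤ) (a : MvPolynomial (Fin (n + 1)) k ⧸ I) :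
    (quotCoaction hI a).coeff t ∈ quotDeg I t := by
  obtain ⟨g, rfl⟩ := Ideal.Quotient.mk_surjective a
  change (polyCoaction I g).coeff t ∈ _
  rw [coeff_polyCoaction]
  exact mk_mem_quotDeg (comp_mem t g)

theorem prod_xbar_mem (s : Finset (Fin (n + 1))) : (∏ j ∈ s, xbar I j) ∈ quotDeg I s.card := by
  simpa using prod_xbar_pow_mem I s 1

theorem isUnit_single {R : Type*} [CommRing R] (t : ℤ) {r : R} (hr : IsUnit r) :
    IsUnit (AddMonoidAlgebra.single t r : LaurentPolynomial R) := by
  rw [LaurentPolynomial.single_eq_C_mul_T]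
  exact (hr.map LaurentPolynomial.C).mul (LaurentPolynomial.isUnit_T t)

/-- The coaction `(S/I)_{x_s} → (S/I)_{x_s}[T, T⁻¹]` defining the grading of `(S/I)_{x_s}`. -/
def locCoaction (s : Finset (Fin (n + 1))) :
    Cech.Loc (xbar I) s →+* LaurentPolynomial (Cech.Loc (xbar I) s) :=
  IsLocalization.lift (M := Submonoid.powers (∏ j ∈ s, xbar I j))
    (g := (AddMonoidAlgebra.mapRingHom ℤ (algebraMap _ (Cech.Loc (xbar I) s))).comp
      (quotCoaction hI)) (by
    rintro ⟨_, m, rfl⟩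
    simp only [map_pow]
    refine IsUnit.pow m ?_
    rw [RingHom.comp_apply, quotCoaction_of_mem hI (prod_xbar_mem s),
      AddMonoidAlgebra.mapRingHom_single]
    exact isUnit_single _ (Cech.isUnit_prod s))

theorem locCoaction_algebraMap (s : Finset (Fin (n + 1))) (a : MvPolynomial (Fin (n + 1)) k ⧸ I) :
    locCoaction hI s (algebraMap _ _ a) =
      AddMonoidAlgebra.mapRingHom ℤ (algebraMap _ (Cech.Loc (xbar I) s)) (quotCoaction hI a) :=
  IsLocalization.lift_eq _ _

theorem locCoaction_algebraMap_of_mem (s : Finset (Fin (n + 1))) {t : ℤ}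
    {a : MvPolynomial (Fin (n + 1)) k ⧸ I} (h : a ∈ quotDeg I t) :
    locCoaction hI s (algebraMap _ _ a) = AddMonoidAlgebra.single t (algebraMap _ _ a) := by
  rw [locCoaction_algebraMap, quotCoaction_of_mem hI h, AddMonoidAlgebra.mapRingHom_single]

/-- The projection of `(S/I)_{x_s}` to its part of degree `t`. -/
def locProj (s : Finset (Fin (n + 1))) (t : ℤ) : Cech.Loc (xbar I) s →+ Cech.Loc (xbar I) s where
  toFun z := (locCoaction hI s z).coeff t
  map_zero' := by simp
  map_add' a b := by simp

theorem locProj_apply (s : Finset (Fin (n + 1))) (t : ℤ) (z : Cech.Loc (xbar I) s) :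
    locProj hI s t z = (locCoaction hI s z).coeff t := rfl

theorem coeff_single_mul {R : Type*} [CommRing R] (t u : ℤ) (r : R) (z : LaurentPolynomial R) :
    (AddMonoidAlgebra.single t r * z).coeff (u + t) = r * z.coeff u := by
  rw [AddMonoidAlgebra.coeff_single_mul_eq_mul_coeff u]
  intro v _
  constructor <;> intro h <;> omega

/-- Multiplication by a power of `x_s` then reduces statements on fractions to their numerators. -/
theorem locProj_mul (s : Finset (Fin (n + 1))) {e : ℤ} {a : MvPolynomial (Fin (n + 1)) k ⧸ I}
    (h : a ∈ quotDeg I e) (t : ℤ) (z : Cech.Loc (xbar I) s) :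
    locProj hI s (t + e) (algebraMap _ _ a * z) = algebraMap _ _ a * locProj hI s t z := by
  rw [locProj_apply, locProj_apply, map_mul, locCoaction_algebraMap_of_mem hI s h, coeff_single_mul]

theorem locProj_eq_self {s : Finset (Fin (n + 1))} {t : ℤ} {z : Cech.Loc (xbar I) s}
    (h : z ∈ locDeg I s t) : locProj hI s t z = z := by
  obtain ⟨m, a, ha, hz⟩ := h
  refine ((Cech.isUnit_prod (x := xbar I) s).pow m).mul_right_injective ?_
  have h1 := locProj_mul hI s (prod_xbar_pow_mem I s m) t z
  rw [map_pow, mul_comm _ z, hz, locProj_apply,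
    locCoaction_algebraMap_of_mem hI s ha, AddMonoidAlgebra.coeff_single, Finsupp.single_eq_same,
    ← hz, mul_comm z] at h1
  exact h1.symm

theorem locProj_mem (s : Finset (Fin (n + 1))) (t : ℤ) (z : Cech.Loc (xbar I) s) :
    locProj hI s t z ∈ locDeg I s t := by
  obtain ⟨m, a, hz⟩ := Cech.exists_loc s z
  refine ⟨m, (quotCoaction hI a).coeff (t + m * s.card), coeff_quotCoaction_mem hI _ a, ?_⟩
  have h1 := locProj_mul hI s (prod_xbar_pow_mem I s m) t z
  rw [map_pow, mul_comm _ z, hz, locProj_apply,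
    locCoaction_algebraMap, AddMonoidAlgebra.coeff_mapRingHom] at h1
  rw [h1, mul_comm]

/-- The coactions commute with restriction because they do so on `S/I`. This makes the projections
maps of complexes. -/
theorem locProj_res {s u : Finset (Fin (n + 1))} (h : s ⊆ u) (t : ℤ) (z : Cech.Loc (xbar I) s) :
    locProj hI u t (Cech.res (xbar I) h z) = Cech.res (xbar I) h (locProj hI s t z) := by
  have : (locCoaction hI u).comp (Cech.res (xbar I) h : _ →+* _) =
      (AddMonoidAlgebra.mapRingHom ℤ (Cech.res (xbar I) h : _ →+* _)).comp (locCoaction hI s) := by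
    refine IsLocalization.ringHom_ext (Submonoid.powers (∏ j ∈ s, xbar I j)) ?_
    refine RingHom.ext fun a => ?_
    simp only [RingHom.comp_apply, RingHom.coe_coe, Cech.res_algebraMap, locCoaction_algebraMap]
    ext v
    simp
  have h2 := congrArg (fun w => w.coeff t) (DFunLike.congr_fun this z)
  simpa [locProj_apply] using h2

/-- The projection of the Čech complex of `S/I` to its part of degree `t`. -/
def cochainProj (t : ℤ) : Cech.Cochain (xbar I) →+ Cech.Cochain (xbar I) where
  toFun α := fun s => locProj hI s t (α s)
  map_zero' := by funext s; simp
  map_add' α β := by funext s; simp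

theorem cochainProj_d (t : ℤ) (α : Cech.Cochain (xbar I)) :
    cochainProj hI t (Cech.d (xbar I) α) = Cech.d (xbar I) (cochainProj hI t α) :=
  Cech.d_map_of_res (fun s => locProj hI s t) (fun h z => locProj_res hI h t z) α

theorem cochainProj_scale {e : ℤ} {a : MvPolynomial (Fin (n + 1)) k ⧸ I}
    (h : a ∈ quotDeg I e) (t : ℤ) (α : Cech.Cochain (xbar I)) :
    cochainProj hI (t + e) (Cech.scale a α) = Cech.scale a (cochainProj hI t α) := by
  funext s
  rw [Cech.scale_apply]
  change locProj hI s (t + e) _ = _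
  rw [Cech.scale_apply, locProj_mul hI s h]
  rfl

theorem cochainProj_mem_supportedOn {P : ℕ → Prop} (t : ℤ) {α : Cech.Cochain (xbar I)}
    (h : α ∈ Cech.supportedOn (xbar I) P) :
    cochainProj hI t α ∈ Cech.supportedOn (xbar I) P := fun s hs => by
  change locProj hI s t _ = _
  rw [h s hs, map_zero]

variable (I) in
/-- The part of degree `t` of the Čech complex of `S/I`. -/
def cochainDeg (t : ℤ) : AddSubgroup (Cech.Cochain (xbar I)) :=
  AddSubgroup.pi Set.univ fun s => locDeg I s t

theorem mem_cochainDeg {t : ℤ} {α : Cech.Cochain (xbar I)} :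
    α ∈ cochainDeg I t ↔ ∀ s, α s ∈ locDeg I s t := by
  simp [cochainDeg, AddSubgroup.mem_pi]

theorem cochainProj_mem (t : ℤ) (α : Cech.Cochain (xbar I)) :
    cochainProj hI t α ∈ cochainDeg I t := mem_cochainDeg.mpr fun s => locProj_mem hI s t _

theorem cochainProj_eq_self {t : ℤ} {α : Cech.Cochain (xbar I)} (h : α ∈ cochainDeg I t) :
    cochainProj hI t α = α := funext fun s => locProj_eq_self hI (mem_cochainDeg.mp h s)

theorem frobCochain_mem_cochainDeg (p : ℕ) [Fact p.Prime]
    (hA : (p : MvPolynomial (Fin (n + 1)) k ⧸ I) = 0) {t : ℤ}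
    {α : Cech.Cochain (xbar I)} (h : α ∈ cochainDeg I t) :
    Cech.frobCochain (xbar I) p hA α ∈ cochainDeg I (p * t) := by
  refine mem_cochainDeg.mpr fun s => ?_
  obtain ⟨m, a, ⟨g, hg, rfl⟩, hz⟩ := mem_cochainDeg.mp h s
  refine ⟨m * p, Ideal.Quotient.mk I (g ^ p), mk_mem_quotDeg ?_, ?_⟩
  · have := IsWeightedHomogeneous.pow hg p
    have e : p • (t + m * s.card) = (p : ℤ) * t + ((m * p : ℕ) : ℤ) * s.card := by
      simp; ring
    rwa [e] at this
  · change (α s) ^ p * _ = _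
    rw [pow_mul, ← mul_pow, hz, map_pow, map_pow]
    rfl

end Graded

end

/-! ### Duality data for `S/J` and their passage to `S/(J + (f))`. -/

noncomputable section

namespace Graded

open MvPolynomial

variable {k : Type*} [Field k] {n : ℕ}

section Functorial

variable {J J' : Ideal (MvPolynomial (Fin (n + 1)) k)} (hle : J ≤ J')

theorem factor_xbar (j : Fin (n + 1)) : Ideal.Quotient.factor hle (xbar J j) = xbar J' j := rfl

/-- The map of Čech complexes induced by `S/J → S/J'` for `J ⊆ J'`. -/
abbrev factorCochain : Cech.Cochain (xbar J) →+ Cech.Cochain (xbar J') :=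
  Cech.mapCochain (Ideal.Quotient.factor hle) (factor_xbar hle)

theorem mapLoc_mem_locDeg {s : Finset (Fin (n + 1))} {t : ℤ} {z : Cech.Loc (xbar J) s}
    (h : z ∈ locDeg J s t) :
    Cech.mapLoc (Ideal.Quotient.factor hle) (factor_xbar hle) s z ∈ locDeg J' s t := by
  obtain ⟨m, _, ⟨g, hg, rfl⟩, hz⟩ := h
  exact ⟨m, Ideal.Quotient.mk J' g, mk_mem_quotDeg hg, Cech.mapLoc_mul_pow _ _ s z hz⟩

theorem factorCochain_mem_cochainDeg {t : ℤ} {α : Cech.Cochain (xbar J)}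
    (h : α ∈ cochainDeg J t) : factorCochain hle α ∈ cochainDeg J' t :=
  mem_cochainDeg.mpr fun s => mapLoc_mem_locDeg hle (mem_cochainDeg.mp h s)

theorem exists_locDeg_lift {s : Finset (Fin (n + 1))} {t : ℤ} {z : Cech.Loc (xbar J') s}
    (h : z ∈ locDeg J' s t) : ∃ w ∈ locDeg J s t,
    Cech.mapLoc (Ideal.Quotient.factor hle) (factor_xbar hle) s w = z := by
  obtain ⟨m, _, ⟨g, hg, rfl⟩, hz⟩ := h
  let w : Cech.Loc (xbar J) s := IsLocalization.mk' _ (Ideal.Quotient.mk J g)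
    (⟨_, m, rfl⟩ : Submonoid.powers (∏ j ∈ s, xbar J j))
  have hw : w * algebraMap _ _ (∏ j ∈ s, xbar J j) ^ m =
      algebraMap _ (Cech.Loc (xbar J) s) (Ideal.Quotient.mk J g) := by
    have := IsLocalization.mk'_spec (Cech.Loc (xbar J) s) (Ideal.Quotient.mk J g)
      (⟨_, m, rfl⟩ : Submonoid.powers (∏ j ∈ s, xbar J j))
    simp only [map_pow] at this
    exact this
  refine ⟨w, ⟨m, _, mk_mem_quotDeg hg, hw⟩, ?_⟩
  refine ((Cech.isUnit_prod (x := xbar J') s).pow m).mul_left_injective ?_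
  have := Cech.mapLoc_mul_pow (Ideal.Quotient.factor hle) (factor_xbar hle) s w hw
  exact this.trans hz.symm

theorem exists_cochainDeg_lift {P : ℕ → Prop} {t : ℤ} {α : Cech.Cochain (xbar J')}
    (hα : α ∈ Cech.supportedOn (xbar J') P) (h : α ∈ cochainDeg J' t) :
    ∃ β ∈ Cech.supportedOn (xbar J) P, β ∈ cochainDeg J t ∧ factorCochain hle β = α := by
  classical
  choose w hw hz using fun s => exists_locDeg_lift hle (mem_cochainDeg.mp h s)
  refine ⟨fun s => if P s.card then w s else 0, fun s hs => if_neg hs,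
    mem_cochainDeg.mpr fun s => ?_, funext fun s => ?_⟩
  · split_ifs
    exacts [hw s, zero_mem _]
  · rw [Cech.mapCochain_apply]
    split_ifs with hs
    · exact hz s
    · rw [map_zero, hα s hs]

end Functorial

section Homogeneous

variable {J : Ideal (MvPolynomial (Fin (n + 1)) k)}

theorem d_mem_cochainDeg (hJ : ∀ g ∈ J, ∀ m, homogeneousComponent m g ∈ J) {t : ℤ}
    {α : Cech.Cochain (xbar J)} (h : α ∈ cochainDeg J t) :
    Cech.d (xbar J) α ∈ cochainDeg J t := by
  rw [← cochainProj_eq_self hJ h, ← cochainProj_d]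
  exact cochainProj_mem hJ t _

/-- Both `γ` and its component of degree `t` have the same product with `f`, and `f` is a
nonzerodivisor. -/
theorem mem_cochainDeg_of_scale (hJ : ∀ g ∈ J, ∀ m, homogeneousComponent m g ∈ J)
    {f : MvPolynomial (Fin (n + 1)) k} {e t : ℤ}
    (hf : f ∈ polyDeg k n e)
    (hreg : ∀ a : MvPolynomial (Fin (n + 1)) k ⧸ J, Ideal.Quotient.mk J f * a = 0 → a = 0)
    {γ : Cech.Cochain (xbar J)}
    (h : Cech.scale (Ideal.Quotient.mk J f) γ ∈ cochainDeg J (t + e)) : γ ∈ cochainDeg J t := by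
  have h1 := cochainProj_eq_self hJ h
  rw [cochainProj_scale hJ (mk_mem_quotDeg hf)] at h1
  rw [← Cech.scale_injective hreg h1]
  exact cochainProj_mem hJ t γ

end Homogeneous

variable (p : ℕ) [hp : Fact p.Prime]

/-- The Frobenius action on functionals `θ : S → k`, thought of as elements of the injective hull
`H^{n+1}_𝔪(S)` of `k`: the monomial `x ^ (p m + p - 1)` is mapped to `θ (x ^ m) ^ p`, all other
monomials are mapped to zero. -/
def frobDual (θ : MvPolynomial (Fin (n + 1)) k →ₗ[k] k) : MvPolynomial (Fin (n + 1)) k →ₗ[k] k :=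
  (basisMonomials (Fin (n + 1)) k).constr k fun m =>
    if ∀ j, m j % p = p - 1 then
      θ (monomial (m.mapRange (· / p) (Nat.zero_div p)) 1) ^ p else 0

variable [CharP k p]

/-- A presentation of `H^i_𝔪(S/J)`, where `i = dim S/J`, as a module of functionals on `S`: a
cocycle is mapped to a functional that vanishes exactly if the cocycle is a coboundary; all
functionals of finite support that vanish on `J` arise; and the gradings and the Frobenius actions correspond to
each other up to a shift by `a` and the multiplication by `F ^ (p - 1)`. -/
structure ResiduePairing (J : Ideal (MvPolynomial (Fin (n + 1)) k)) (i : ℕ) (a : ℤ)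
    (F : MvPolynomial (Fin (n + 1)) k) where
  vanishing : ∀ j < i, Cech.cocycles (xbar J) j ≤ Cech.coboundaries (xbar J) j
  toDual : Cech.cocycles (xbar J) i →+ (MvPolynomial (Fin (n + 1)) k →ₗ[k] k)
  eq_zero_iff : ∀ α, toDual α = 0 ↔ α.1 ∈ Cech.coboundaries (xbar J) i
  scale : ∀ g (α : Cech.cocycles (xbar J) i) h,
      toDual (Cech.scaleCocycle (Ideal.Quotient.mk J g) α) h =
    toDual α (g * h)
  surjective : ∀ (D : ℤ) (θ : MvPolynomial (Fin (n + 1)) k →ₗ[k] k), (∀ g ∈ J, θ g = 0) →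
    (∀ g, θ (comp D g) = θ g) → ∃ α, α.1 ∈ cochainDeg J (a - D) ∧
      toDual α = θ
  degree : ∀ t D (α : Cech.cocycles (xbar J) i) g, α.1 ∈ cochainDeg J t → g ∈ polyDeg k n D →
    t + D ≠ a → toDual α g = 0
  frob : ∀ α h, toDual (Cech.frobCocycles (xbar J) p (quot_natCast_eq_zero J p) i α) h =
    frobDual p (toDual α) (F ^ (p - 1) * h)

namespace ResiduePairing

variable {p} {J J' : Ideal (MvPolynomial (Fin (n + 1)) k)} {i : ℕ} {a : ℤ}
  {F f : MvPolynomial (Fin (n + 1)) k}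

/-- Passage to the quotient by a homogeneous nonzerodivisor of `S/J`. -/
theorem nonempty_quotient (P : ResiduePairing p J (i + 1) a F)
    (hJ : ∀ g ∈ J, ∀ m, homogeneousComponent m g ∈ J) {e : ℕ} (hf : f.IsHomogeneous e)
    (hreg : ∀ g, f * g ∈ J → g ∈ J) (hJ' : J' = J ⊔ Ideal.span {f}) :
    Nonempty (ResiduePairing p J' i (a + e) (F * f)) := by
  have hle : J ≤ J' := hJ' ▸ le_sup_left
  have hfJ' : f ∈ J' := hJ' ▸ Ideal.mem_sup_right (Ideal.mem_span_singleton_self f)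
  have hf' := isHomogeneous_iff_mem_polyDeg.mp hf
  let f' := Ideal.Quotient.mk J f
  let φ := Ideal.Quotient.factor hle
  let hφ := factor_xbar hle
  have hφf : φ f' = 0 := Ideal.Quotient.eq_zero_iff_mem.mpr hfJ'
  have hsurj : Function.Surjective φ := Ideal.Quotient.factor_surjective hle
  have hreg' : ∀ b, f' * b = 0 → b = 0 := by
    intro b hb
    obtain ⟨g, rfl⟩ := Ideal.Quotient.mk_surjective b
    rw [← map_mul] at hb
    exact Ideal.Quotient.eq_zero_iff_mem.mpr (hreg g (Ideal.Quotient.eq_zero_iff_mem.mp hb))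
  have hker : ∀ b, φ b = 0 → ∃ c, b = f' * c := by
    intro b hb
    obtain ⟨g, rfl⟩ := Ideal.Quotient.mk_surjective b
    have hg : g ∈ J' := Ideal.Quotient.eq_zero_iff_mem.mp hb
    rw [hJ', Submodule.mem_sup] at hg
    obtain ⟨u, hu, v, hv, rfl⟩ := hg
    obtain ⟨c, rfl⟩ := Ideal.mem_span_singleton'.mp hv
    refine ⟨Ideal.Quotient.mk J c, ?_⟩
    rw [← map_mul, map_add, Ideal.Quotient.eq_zero_iff_mem.mpr hu, zero_add, mul_comm]
  have hvan := P.vanishing i (Nat.lt_succ_self i)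
  obtain ⟨hex, Δ, hΔ, hΔ0⟩ := Cech.exists_connects φ hφ hsurj hφf hker hreg' hvan P.toDual
    P.eq_zero_iff
  refine ⟨{
    vanishing := fun j hj => Cech.cocycles_le_coboundaries_of_quotient φ hφ hsurj hφf hker hreg'
      (P.vanishing j (by omega)) (P.vanishing (j + 1) (by omega))
    toDual := Δ
    eq_zero_iff := hΔ0
    scale := fun g α h => ?_
    surjective := fun d θ hθJ hθd => ?_
    degree := fun t d α g hα hg hne => ?_
    frob := fun α h => ?_ }⟩
  · obtain ⟨γ, hγ⟩ := hex α
    have h1 : Δ (Cech.scaleCocycle (Ideal.Quotient.mk J' g) α) =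
        P.toDual (Cech.scaleCocycle (Ideal.Quotient.mk J g) γ) :=
      hΔ _ _ (hγ.scale (Ideal.Quotient.mk J g))
    rw [hΔ α γ hγ, ← P.scale, h1]
  -- The functional comes from a class `γ` over `S/J`. Since `θ` kills `f S`, the cocycle `f γ` has
  -- zero functional and is some `dβ`; the image of `β` in `S/J'` is the required cocycle.
  · obtain ⟨γ, hγd, hγ⟩ := P.surjective d θ (fun g hg => hθJ g (hle hg)) hθd
    have h1 : Cech.scale f' γ.1 ∈ Cech.coboundaries (xbar J) (i + 1) := by
      refine (P.eq_zero_iff (Cech.scaleCocycle f' γ)).mp ?_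
      refine LinearMap.ext fun g => ?_
      rw [P.scale, hγ]
      exact hθJ _ (J'.mul_mem_right g hfJ')
    obtain ⟨β, hβ, hβd⟩ := Cech.mem_coboundaries_succ.mp h1
    -- Nothing makes `β` homogeneous, so it is replaced by its component in the degree of `f γ`.
    have hβ' : cochainProj hJ (a - d + e) β ∈ Cech.supportedOn (xbar J) (fun m => m = i) :=
      cochainProj_mem_supportedOn hJ _ hβ
    have hdβ' : Cech.d (xbar J) (cochainProj hJ (a - d + e) β) = Cech.scale f' γ.1 := by
      rw [← cochainProj_d, hβd, cochainProj_scale hJ (mk_mem_quotDeg hf'),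
        cochainProj_eq_self hJ hγd]
    have hβm : cochainProj hJ (a - d + e) β ∈ cochainDeg J (a + e - d) := by
      rw [show a + e - d = a - d + e by ring]
      exact cochainProj_mem hJ _ β
    generalize cochainProj hJ (a - d + e) β = β' at hβ' hdβ' hβm
    have hcoc : Cech.mapCochain φ hφ β' ∈ Cech.cocycles (xbar J') i := by
      refine Cech.mem_cocycles.mpr ⟨Cech.mapCochain_mem_supportedOn φ hφ hβ', ?_⟩
      rw [← Cech.mapCochain_d, hdβ', Cech.mapCochain_scale, hφf, Cech.zero_scale]
    refine ⟨⟨_, hcoc⟩, factorCochain_mem_cochainDeg hle hβm, ?_⟩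
    rw [hΔ ⟨_, hcoc⟩ γ ⟨β', hβ', rfl, hdβ'⟩, hγ]
  -- A homogeneous lift of degree `t` has a differential `f γ` of degree `t`, so `γ` has degree `t -
  -- e`. This is the shift from `a` to `a + e`.
  · obtain ⟨β, hβ, hβt, hβα⟩ := exists_cochainDeg_lift hle α.2.1 hα
    have h0 : Cech.mapCochain φ hφ (Cech.d (xbar J) β) = 0 := by
      rw [Cech.mapCochain_d]
      exact (congrArg (Cech.d (xbar J')) hβα).trans α.2.2
    obtain ⟨γ, -, hγ⟩ := Cech.exists_smul_of_mapCochain_eq_zero φ hφ hker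
      (Cech.d_mem_supportedOn hβ) h0
    have hcon : Cech.Connecting φ hφ f' i α.1 γ := ⟨β, hβ, hβα, hγ⟩
    rw [hΔ α ⟨γ, hcon.mem_cocycles hreg'⟩ hcon]
    refine P.degree (t - e) d _ g ?_ hg (fun h => hne (by linarith))
    refine mem_cochainDeg_of_scale hJ hf' hreg' ?_
    rw [sub_add_cancel]
    have h1 := d_mem_cochainDeg hJ hβt
    rwa [hγ, ← Cech.scale_def] at h1
  · obtain ⟨γ, hγ⟩ := hex α
    have h1 : Δ (Cech.frobCocycles (xbar J') p (quot_natCast_eq_zero J' p) i α) =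
        P.toDual (Cech.scaleCocycle (f' ^ (p - 1))
          (Cech.frobCocycles (xbar J) p (quot_natCast_eq_zero J p) (i + 1) γ)) :=
      hΔ _ _ hγ.frob
    have h2 : f' ^ (p - 1) = Ideal.Quotient.mk J (f ^ (p - 1)) := (map_pow _ _ _).symm
    have h3 := h1.trans (congrArg (fun b => P.toDual (Cech.scaleCocycle b
      (Cech.frobCocycles (xbar J) p (quot_natCast_eq_zero J p) (i + 1) γ))) h2)
    refine (DFunLike.congr_fun h3 h).trans ((P.scale _ _ h).trans ((P.frob γ _).trans ?_))
    have h4 : F ^ (p - 1) * (f ^ (p - 1) * h) = (F * f) ^ (p - 1) * h := by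
      rw [mul_pow, mul_assoc]
    exact (congrArg (frobDual p (P.toDual γ)) h4).trans
      (congrArg (fun θ => frobDual p θ ((F * f) ^ (p - 1) * h)) (hΔ α γ hγ).symm)

end ResiduePairing

end Graded

end

/-! ### The Čech complex of the polynomial ring inside Laurent polynomials. -/

noncomputable section

namespace Cech

variable {N : ℕ}

/-- The sign with which the `j`-th face enters the Čech differential. -/
def faceSign (j : Fin N) (s : Finset (Fin N)) : ℤ := (-1) ^ (s.filter (· < j)).card

theorem faceSign_mul_self (j : Fin N) (s : Finset (Fin N)) : faceSign j s * faceSign j s = 1 := by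
  rw [faceSign, ← mul_pow]
  simp

/-- The sign rule behind `d ∘ d = 0`: removing two elements in the two orders gives opposite signs.
-/
theorem faceSign_swap {j l : Fin N} {t : Finset (Fin N)} (hj : j ∉ t) (hl : l ∈ t) :
    faceSign l t * faceSign j (insert j (t.erase l)) =
      -(faceSign j (insert j t) * faceSign l (insert j t)) := by
  have hne : l ≠ j := fun h => hj (h ▸ hl)
  have e1 : (insert j t).erase j = t := Finset.erase_insert hj
  have e2 : (insert j t).erase l = insert j (t.erase l) := Finset.erase_insert_of_ne hne.symm
  simp only [faceSign]
  rcases lt_or_gt_of_ne hne with h | h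
  · obtain ⟨h1, h2⟩ := card_aux (Finset.mem_insert_of_mem (b := j) hl) h
    rw [e1] at h2
    rw [e2] at h1
    rw [h1, h2]; ring
  · obtain ⟨h1, h2⟩ := card_aux (Finset.mem_insert_self j t) h
    rw [e1] at h1
    rw [e2] at h2
    rw [h1, h2]; ring

/-- A contracting homotopy for the complex of functions on subsets. -/
theorem sum_faceSign_contraction {R : Type*} [AddCommGroup R] (u : Finset (Fin N) → R)
    (h : ∀ t : Finset (Fin N), ∑ l ∈ t, faceSign l t • u (t.erase l) = 0) (j : Fin N)
    (t : Finset (Fin N)) :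
    ∑ l ∈ t, faceSign l t •
      (if j ∈ t.erase l then 0 else
        faceSign j (insert j (t.erase l)) • u (insert j (t.erase l))) = u t := by
  by_cases hj : j ∈ t
  -- Every `t.erase l` with `l ≠ j` still contains `j`, so only the term `l = j` survives.
  · rw [Finset.sum_eq_single_of_mem j hj]
    · rw [if_neg (Finset.notMem_erase j t), Finset.insert_erase hj, smul_smul, faceSign_mul_self,
        one_smul]
    · intro l hl hne
      rw [if_pos (Finset.mem_erase.mpr ⟨hne.symm, hj⟩), smul_zero]
  -- Here the cocycle relation on `insert j t` expresses `u t` through the other faces.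
  · have h1 := h (insert j t)
    rw [Finset.sum_insert hj, Finset.erase_insert hj] at h1
    have h2 : ∑ l ∈ t, faceSign l t •
        (if j ∈ t.erase l then 0 else
          faceSign j (insert j (t.erase l)) • u (insert j (t.erase l))) =
        -(faceSign j (insert j t) • ∑ l ∈ t, faceSign l (insert j t) •
          u ((insert j t).erase l)) := by
      rw [Finset.smul_sum, ← Finset.sum_neg_distrib]
      refine Finset.sum_congr rfl fun l hl => ?_
      have hne : j ≠ l := fun e => hj (e ▸ hl)
      rw [if_neg fun hm => hj (Finset.mem_of_mem_erase hm), smul_smul, faceSign_swap hj hl,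
        Finset.erase_insert_of_ne hne, smul_smul, neg_smul]
    rw [h2, ← neg_eq_of_add_eq_zero_right h1, smul_neg, neg_neg, smul_smul, faceSign_mul_self,
      one_smul]

/-- Taking `T s` to be a coefficient of the Laurent expansion splits the Čech complex of `S` into
complexes of scalar functions on subsets, one for each exponent. -/
theorem map_d_of_res {A : Type*} [CommRing A] {x : Fin N → A} {M : Type*} [AddCommGroup M]
    (T : ∀ s, Loc x s →+ M)
    (hT : ∀ {s t : Finset (Fin N)} (h : s ⊆ t) z, T t (res x h z) = T s z)
    (α : Cochain x) (t : Finset (Fin N)) :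
    T t (d x α t) = ∑ l ∈ t, faceSign l t • T (t.erase l) (α (t.erase l)) := by
  rw [d_apply, map_sum]
  refine Finset.sum_congr rfl fun j _ => ?_
  rw [← hT (Finset.erase_subset j t), faceSign]
  generalize (t.filter (· < j)).card = m
  rcases Nat.even_or_odd m with h | h <;> simp [h]

end Cech

namespace Graded

open MvPolynomial

variable {k : Type*} [Field k] {n : ℕ}

/-- The ring of Laurent polynomials in `x_0, …, x_n`. -/
abbrev Laurent (k : Type*) [Field k] (n : ℕ) : Type _ := AddMonoidAlgebra k (Fin (n + 1) → ℤ)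

/-- The exponent of a monomial as an integer vector. -/
def intExp (n : ℕ) : (Fin (n + 1) →₀ ℕ) →+ (Fin (n + 1) → ℤ) where
  toFun d := fun j => d j
  map_zero' := by funext j; simp
  map_add' d e := by funext j; simp

theorem intExp_apply (d : Fin (n + 1) →₀ ℕ) (j : Fin (n + 1)) : intExp n d j = d j := rfl

theorem intExp_injective : Function.Injective (intExp n) := fun d e h => by
  ext j
  exact Nat.cast_injective (R := ℤ) (congrFun h j)

theorem exists_intExp_eq {v : Fin (n + 1) → ℤ} (hv : ∀ j, 0 ≤ v j) : ∃ d, intExp n d = v :=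
  ⟨Finsupp.equivFunOnFinite.symm fun j => (v j).toNat, by
    funext j
    simp [intExp_apply, hv j]⟩

theorem sum_intExp (d : Fin (n + 1) →₀ ℕ) : ∑ j, intExp n d j = d.degree := by
  simp [intExp_apply, Finsupp.degree_eq_sum]

/-- The inclusion of polynomials into Laurent polynomials. -/
def toLaurent (k : Type*) [Field k] (n : ℕ) :
    MvPolynomial (Fin (n + 1)) k →ₐ[k] Laurent k n :=
  AddMonoidAlgebra.mapDomainAlgHom k k (intExp n)

theorem toLaurent_monomial (d : Fin (n + 1) →₀ ℕ) (c : k) :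
    toLaurent k n (monomial d c) = AddMonoidAlgebra.single (intExp n d) c := by
  exact AddMonoidAlgebra.mapDomain_single

theorem coeff_toLaurent (g : MvPolynomial (Fin (n + 1)) k) (d : Fin (n + 1) →₀ ℕ) :
    (toLaurent k n g).coeff (intExp n d) = coeff d g := by
  induction g using MvPolynomial.induction_on' with
  | monomial e c =>
    rw [toLaurent_monomial, AddMonoidAlgebra.coeff_single, coeff_monomial, Finsupp.single_apply]
    simp only [intExp_injective.eq_iff]
  | add g h hg hh =>
    rw [map_add, AddMonoidAlgebra.coeff_add, Finsupp.add_apply, hg, hh, coeff_add]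

theorem exists_of_coeff_toLaurent_ne_zero {g : MvPolynomial (Fin (n + 1)) k} {v : Fin (n + 1) → ℤ}
    (h : (toLaurent k n g).coeff v ≠ 0) : ∃ d, intExp n d = v ∧ coeff d g ≠ 0 := by
  suffices ∃ d, intExp n d = v by
    obtain ⟨d, rfl⟩ := this
    exact ⟨d, rfl, coeff_toLaurent g d ▸ h⟩
  by_contra hv
  refine h ?_
  clear h
  induction g using MvPolynomial.induction_on' with
  | monomial e c =>
    rw [toLaurent_monomial, AddMonoidAlgebra.coeff_single, Finsupp.single_apply,
      if_neg fun h => hv ⟨e, h⟩]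
  | add g h hg hh => 
    rw [map_add, AddMonoidAlgebra.coeff_add, Finsupp.add_apply, hg, hh, add_zero]

theorem toLaurent_injective : Function.Injective (toLaurent k n) := fun g h e => by
  ext d
  rw [← coeff_toLaurent, e, coeff_toLaurent]

/-- The exponent of `∏_{j ∈ s} x_j`. -/
def indicator (s : Finset (Fin (n + 1))) : Fin (n + 1) → ℤ := fun j => if j ∈ s then 1 else 0

theorem toLaurent_prod_X (s : Finset (Fin (n + 1))) :
    toLaurent k n (∏ j ∈ s, X j) = AddMonoidAlgebra.single (indicator s) 1 := by
  have : (∏ j ∈ s, X j : MvPolynomial (Fin (n + 1)) k) =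
      monomial (∑ j ∈ s, Finsupp.single j 1) 1 := by
    rw [monomial_sum_one]
    rfl
  rw [this, toLaurent_monomial]
  congr 1
  funext j
  simp [intExp_apply, indicator, Finsupp.single_apply]

theorem coeff_mul_single_add (w : Laurent k n) (v u : Fin (n + 1) → ℤ) (c : k) :
    (w * AddMonoidAlgebra.single u c).coeff (v + u) = w.coeff v * c :=
  AddMonoidAlgebra.coeff_mul_single_eq_coeff_mul v fun _ _ => add_left_inj u

theorem single_mul_single_neg (v : Fin (n + 1) → ℤ) :
    (AddMonoidAlgebra.single v 1 : Laurent k n) * AddMonoidAlgebra.single (-v) 1 = 1 := by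
  rw [AddMonoidAlgebra.single_mul_single, add_neg_cancel, one_mul]
  rfl

theorem isUnit_single_one (v : Fin (n + 1) → ℤ) :
    IsUnit (AddMonoidAlgebra.single v 1 : Laurent k n) :=
  IsUnit.of_mul_eq_one _ (single_mul_single_neg v)

/-- The inclusion of `S/0` into Laurent polynomials. -/
def quotToLaurent (k : Type*) [Field k] (n : ℕ) :
    MvPolynomial (Fin (n + 1)) k ⧸ (⊥ : Ideal (MvPolynomial (Fin (n + 1)) k)) →+* Laurent k n :=
  Ideal.Quotient.lift ⊥ (toLaurent k n : _ →+* _) fun g hg => by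
    rw [(Submodule.mem_bot _).mp hg, map_zero]

theorem quotToLaurent_prod (s : Finset (Fin (n + 1))) :
    quotToLaurent k n (∏ j ∈ s, xbar (⊥ : Ideal (MvPolynomial (Fin (n + 1)) k)) j) =
        AddMonoidAlgebra.single (indicator s) 1 := by
  rw [← toLaurent_prod_X, map_prod, map_prod]
  rfl

/-- The inclusion of `S_{x_s}` into Laurent polynomials. -/
def locToLaurent (k : Type*) [Field k] {n : ℕ} (s : Finset (Fin (n + 1))) :
    Cech.Loc (xbar (⊥ : Ideal (MvPolynomial (Fin (n + 1)) k))) s →+* Laurent k n :=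
  IsLocalization.lift (M := Submonoid.powers (∏ j ∈ s,
      xbar (⊥ : Ideal (MvPolynomial (Fin (n + 1)) k)) j)) (g := quotToLaurent k n) (by
    rintro ⟨_, m, rfl⟩
    simp only [map_pow]
    rw [quotToLaurent_prod]
    exact (isUnit_single_one _).pow m)

theorem locToLaurent_algebraMap (s : Finset (Fin (n + 1))) (g : MvPolynomial (Fin (n + 1)) k) :
    locToLaurent k s (algebraMap _ _ (Ideal.Quotient.mk ⊥ g)) = toLaurent k n g :=
  IsLocalization.lift_eq _ _

theorem locToLaurent_res {s t : Finset (Fin (n + 1))} (h : s ⊆ t)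
    (z : Cech.Loc (xbar (⊥ : Ideal (MvPolynomial (Fin (n + 1)) k))) s) :
    locToLaurent k t (Cech.res (xbar (⊥ : Ideal (MvPolynomial (Fin (n + 1)) k))) h z) =
        locToLaurent k s z := by
  have : (locToLaurent k t).comp (Cech.res (xbar (⊥ : Ideal (MvPolynomial (Fin (n + 1)) k))) h :
      _ →+* _) = locToLaurent k s := by
    refine IsLocalization.ringHom_ext (Submonoid.powers
        (∏ j ∈ s, xbar (⊥ : Ideal (MvPolynomial (Fin (n + 1)) k)) j)) ?_
    refine RingHom.ext fun a => ?_
    obtain ⟨g, rfl⟩ := Ideal.Quotient.mk_surjective a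
    simp only [RingHom.comp_apply, RingHom.coe_coe, Cech.res_algebraMap, locToLaurent_algebraMap]
  exact DFunLike.congr_fun this z

theorem exists_locToLaurent_mul (s : Finset (Fin (n + 1)))
    (z : Cech.Loc (xbar (⊥ : Ideal (MvPolynomial (Fin (n + 1)) k))) s) :
    ∃ (m : ℕ) (g : MvPolynomial (Fin (n + 1)) k),
      z * algebraMap _ _ (∏ j ∈ s, xbar (⊥ : Ideal (MvPolynomial (Fin (n + 1)) k)) j) ^ m =
          algebraMap _ _ (Ideal.Quotient.mk ⊥ g) := by
  obtain ⟨m, a, h⟩ := Cech.exists_loc s z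
  obtain ⟨g, rfl⟩ := Ideal.Quotient.mk_surjective a
  exact ⟨m, g, h⟩

theorem locToLaurent_mul {s : Finset (Fin (n + 1))}
    {z : Cech.Loc (xbar (⊥ : Ideal (MvPolynomial (Fin (n + 1)) k))) s} {m : ℕ}
    {g : MvPolynomial (Fin (n + 1)) k}
    (h : z * algebraMap _ _ (∏ j ∈ s, xbar (⊥ : Ideal (MvPolynomial (Fin (n + 1)) k)) j) ^ m =
        algebraMap _ _ (Ideal.Quotient.mk ⊥ g)) :
    locToLaurent k s z * AddMonoidAlgebra.single (m • indicator s) 1 = toLaurent k n g := by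
  have h1 := congrArg (locToLaurent k s) h
  have h2 : locToLaurent k s (algebraMap _ _ (∏ j ∈ s,
      xbar (⊥ : Ideal (MvPolynomial (Fin (n + 1)) k)) j)) =
      AddMonoidAlgebra.single (indicator s) 1 := by
    rw [← quotToLaurent_prod]
    exact IsLocalization.lift_eq _ _
  rw [map_mul, map_pow, h2, locToLaurent_algebraMap, AddMonoidAlgebra.single_pow, one_pow] at h1
  exact h1

theorem coeff_locToLaurent {s : Finset (Fin (n + 1))}
    {z : Cech.Loc (xbar (⊥ : Ideal (MvPolynomial (Fin (n + 1)) k))) s} {m : ℕ}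
    {g : MvPolynomial (Fin (n + 1)) k}
    (h : z * algebraMap _ _ (∏ j ∈ s, xbar (⊥ : Ideal (MvPolynomial (Fin (n + 1)) k)) j) ^ m =
        algebraMap _ _ (Ideal.Quotient.mk ⊥ g))
    (v : Fin (n + 1) → ℤ) :
    (locToLaurent k s z).coeff v = (toLaurent k n g).coeff (v + m • indicator s) := by
  rw [← locToLaurent_mul h, coeff_mul_single_add, mul_one]

theorem locToLaurent_injective (s : Finset (Fin (n + 1))) :
    Function.Injective (locToLaurent k s) := by
  rw [injective_iff_map_eq_zero]
  intro z hz
  obtain ⟨m, g, h⟩ := exists_locToLaurent_mul s z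
  have h1 := locToLaurent_mul h
  rw [hz, zero_mul] at h1
  have h2 : g = 0 := toLaurent_injective (by rw [← h1, map_zero])
  rw [h2, map_zero, map_zero] at h
  exact ((Cech.isUnit_prod s).pow m).mul_left_eq_zero.mp h

theorem nonneg_of_coeff_locToLaurent_ne_zero {s : Finset (Fin (n + 1))}
    {z : Cech.Loc (xbar (⊥ : Ideal (MvPolynomial (Fin (n + 1)) k))) s} {v : Fin (n + 1) → ℤ}
    (hv : (locToLaurent k s z).coeff v ≠ 0) {j : Fin (n + 1)} (hj : j ∉ s) : 0 ≤ v j := by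
  obtain ⟨m, g, h⟩ := exists_locToLaurent_mul s z
  rw [coeff_locToLaurent h] at hv
  obtain ⟨d, hd, -⟩ := exists_of_coeff_toLaurent_ne_zero hv
  have := congrFun hd j
  simp [intExp_apply, indicator, hj] at this
  omega

/-- With `nonneg_of_coeff_locToLaurent_ne_zero`, this describes `S_{x_s}` as the span of the Laurent
monomials with nonnegative exponents outside `s`. -/
theorem exists_locToLaurent_eq {s : Finset (Fin (n + 1))} {w : Laurent k n}
    (hw : ∀ v, w.coeff v ≠ 0 → ∀ j, j ∉ s → 0 ≤ v j) : ∃ z, locToLaurent k s z = w := by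
  change w ∈ (locToLaurent k s).range
  rw [← AddMonoidAlgebra.sum_coeff_single w]
  refine sum_mem fun v hv => ?_
  have hv' := hw v (Finsupp.mem_support_iff.mp hv)
  -- Large enough for `x_s ^ m` to clear every negative exponent of `x ^ v`.
  let m : ℕ := ∑ j, (v j).natAbs
  have hm : ∀ j, 0 ≤ (v + m • indicator s) j := by
    intro j
    by_cases hj : j ∈ s
    · have : (v j).natAbs ≤ m := Finset.single_le_sum (f := fun j => (v j).natAbs)
        (fun _ _ => Nat.zero_le _) (Finset.mem_univ j)
      simp [indicator, hj]
      omega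
    · simpa [indicator, hj] using hv' j hj
  obtain ⟨d, hd⟩ := exists_intExp_eq hm
  let z : Cech.Loc (xbar (⊥ : Ideal (MvPolynomial (Fin (n + 1)) k))) s :=
    IsLocalization.mk' _ (Ideal.Quotient.mk ⊥ (monomial d (w.coeff v)))
    (⟨_, m, rfl⟩ : Submonoid.powers (∏ j ∈ s, xbar (⊥ : Ideal (MvPolynomial (Fin (n + 1)) k)) j))
  have hz := IsLocalization.mk'_spec
    (Cech.Loc (xbar (⊥ : Ideal (MvPolynomial (Fin (n + 1)) k))) s)
    (Ideal.Quotient.mk ⊥ (monomial d (w.coeff v)))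
    (⟨_, m, rfl⟩ : Submonoid.powers (∏ j ∈ s, xbar (⊥ : Ideal (MvPolynomial (Fin (n + 1)) k)) j))
  simp only [map_pow] at hz
  refine ⟨z, ?_⟩
  have h1 := locToLaurent_mul (z := z) hz
  rw [toLaurent_monomial, hd] at h1
  refine (isUnit_single_one (m • indicator s)).mul_left_injective ?_
  change _ * _ = _ * _
  rw [h1, AddMonoidAlgebra.single_mul_single, mul_one]

theorem mem_locDeg_bot_iff {s : Finset (Fin (n + 1))} {t : ℤ}
    {z : Cech.Loc (xbar (⊥ : Ideal (MvPolynomial (Fin (n + 1)) k))) s} :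
    z ∈ locDeg ⊥ s t ↔ ∀ v, (locToLaurent k s z).coeff v ≠ 0 → ∑ j, v j = t := by
  have hsum : ∀ (v : Fin (n + 1) → ℤ) (m : ℕ),
      ∑ j, (v + m • indicator s) j = ∑ j, v j + m * s.card := by
    intro v m
    simp [Finset.sum_add_distrib, indicator, mul_comm]
  constructor
  · rintro ⟨m, _, ⟨g, hg, rfl⟩, h⟩ v hv
    rw [coeff_locToLaurent h] at hv
    obtain ⟨d, hd, hne⟩ := exists_of_coeff_toLaurent_ne_zero hv
    have h1 := mem_polyDeg.mp hg d hne
    rw [← sum_intExp, hd, hsum] at h1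
    exact add_right_cancel h1
  · intro hv
    obtain ⟨m, g, h⟩ := exists_locToLaurent_mul s z
    refine ⟨m, _, mk_mem_quotDeg (mem_polyDeg.mpr fun d hd => ?_), h⟩
    have h1 := hv (intExp n d - m • indicator s) (by
      rw [coeff_locToLaurent h, sub_add_cancel, coeff_toLaurent]
      exact hd)
    rw [← h1, ← hsum, sub_add_cancel, sum_intExp]

end Graded

end

/-! ### The residue pairing and the top local cohomology of the polynomial ring. -/

noncomputable section

namespace Graded

open MvPolynomial

variable {k : Type*} [Field k] {n : ℕ}

/-- The functional on `S` defined by a Laurent polynomial `w` via the residue, that is, the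
coefficient of `(x_0 ⋯ x_n)⁻¹`, of products with `w`. -/
def residueDual (w : Laurent k n) : MvPolynomial (Fin (n + 1)) k →ₗ[k] k where
  toFun g := (toLaurent k n g * w).coeff (-1)
  map_add' g h := by rw [map_add, add_mul, AddMonoidAlgebra.coeff_add, Finsupp.add_apply]
  map_smul' c g := by
    rw [map_smul, smul_mul_assoc, AddMonoidAlgebra.coeff_smul, Finsupp.smul_apply]
    rfl

theorem residueDual_apply (w : Laurent k n) (g : MvPolynomial (Fin (n + 1)) k) :
    residueDual w g = (toLaurent k n g * w).coeff (-1) := rfl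

theorem residueDual_add (w w' : Laurent k n) :
    residueDual (w + w') = residueDual w + residueDual w' := by
  refine LinearMap.ext fun g => ?_
  rw [LinearMap.add_apply, residueDual_apply, residueDual_apply, residueDual_apply, mul_add,
    AddMonoidAlgebra.coeff_add, Finsupp.add_apply]

theorem residueDual_mul (w : Laurent k n) (g h : MvPolynomial (Fin (n + 1)) k) :
    residueDual (toLaurent k n g * w) h = residueDual w (g * h) := by
  rw [residueDual_apply, residueDual_apply, map_mul]
  congr 2
  ring

theorem residueDual_monomial (w : Laurent k n) (d : Fin (n + 1) →₀ ℕ) (c : k) :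
    residueDual w (monomial d c) = c * w.coeff (-1 - intExp n d) := by
  rw [residueDual_apply, toLaurent_monomial, mul_comm]
  have := coeff_mul_single_add w (-1 - intExp n d) (intExp n d) c
  rw [sub_add_cancel] at this
  rw [this, mul_comm]

theorem residueDual_eq_sum (w : Laurent k n) (g : MvPolynomial (Fin (n + 1)) k) :
    residueDual w g = ∑ d ∈ g.support, coeff d g * w.coeff (-1 - intExp n d) := by
  conv_lhs => rw [g.as_sum, map_sum]
  exact Finset.sum_congr rfl fun d _ => residueDual_monomial w d _

theorem dual_ext {θ θ' : MvPolynomial (Fin (n + 1)) k →ₗ[k] k}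
    (h : ∀ d, θ (monomial d 1) = θ' (monomial d 1)) : θ = θ' :=
  (basisMonomials (Fin (n + 1)) k).ext fun d => by simpa using h d

theorem exists_neg_one_sub {v : Fin (n + 1) → ℤ} (hv : ∀ j, v j < 0) :
    ∃ d, -1 - intExp n d = v := by
  obtain ⟨d, hd⟩ := exists_intExp_eq (n := n) (v := -1 - v) fun j => by
    have := hv j
    simp only [Pi.sub_apply, Pi.neg_apply, Pi.one_apply]
    omega
  exact ⟨d, by rw [hd]; ring⟩

/-- The residue sees exactly the coefficients at exponents `-1 - d` with `d ≥ 0`, that is, at those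
with all coordinates negative. -/
theorem residueDual_eq_zero_iff (w : Laurent k n) :
    residueDual w = 0 ↔ ∀ v, (∀ j, v j < 0) → w.coeff v = 0 := by
  constructor
  · intro h v hv
    obtain ⟨d, rfl⟩ := exists_neg_one_sub hv
    have := residueDual_monomial w d 1
    rwa [h, LinearMap.zero_apply, one_mul, eq_comm] at this
  · intro h
    refine dual_ext fun d => ?_
    rw [residueDual_monomial, LinearMap.zero_apply, h, mul_zero]
    intro j
    simp only [Pi.sub_apply, Pi.neg_apply, Pi.one_apply, intExp_apply]
    omega

theorem frobDual_monomial (p : ℕ) (θ : MvPolynomial (Fin (n + 1)) k →ₗ[k] k)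
    (m : Fin (n + 1) →₀ ℕ) :
    frobDual p θ (monomial m 1) = if ∀ j, m j % p = p - 1 then
      θ (monomial (m.mapRange (· / p) (Nat.zero_div p)) 1) ^ p else 0 := by
  have := (basisMonomials (Fin (n + 1)) k).constr_basis k (fun m =>
    if ∀ j, m j % p = p - 1 then
      θ (monomial (m.mapRange (· / p) (Nat.zero_div p)) 1) ^ p else 0) m
  rwa [coe_basisMonomials] at this

section Frobenius

variable (p : ℕ) [hp : Fact p.Prime] [CharP k p]

theorem add_pow_laurent (w w' : Laurent k n) : (w + w') ^ p = w ^ p + w' ^ p := by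
  have h : (p : Laurent k n) = 0 := by
    rw [← map_natCast (algebraMap k (Laurent k n)), CharP.cast_eq_zero, map_zero]
  exact map_add (Cech.frob p h) w w'

theorem coeff_pow_smul (w : Laurent k n) (v : Fin (n + 1) → ℤ) :
    (w ^ p).coeff ((p : ℤ) • v) = w.coeff v ^ p := by
  have hp0 : (p : ℤ) ≠ 0 := by exact_mod_cast hp.out.ne_zero
  induction w using AddMonoidAlgebra.induction_linear with
  | zero => simp [zero_pow hp.out.ne_zero]
  | add w w' h h' =>
    rw [add_pow_laurent, AddMonoidAlgebra.coeff_add, AddMonoidAlgebra.coeff_add,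
      Finsupp.add_apply, Finsupp.add_apply, h, h', add_pow_char]
  | single u c =>
    rw [AddMonoidAlgebra.single_pow, AddMonoidAlgebra.coeff_single, AddMonoidAlgebra.coeff_single,
      Finsupp.single_apply, Finsupp.single_apply, ← natCast_zsmul]
    by_cases h : u = v
    · rw [if_pos h, if_pos (by rw [h])]
    · rw [if_neg h, if_neg, zero_pow hp.out.ne_zero]
      exact fun e => h (smul_right_injective _ hp0 e)

theorem coeff_pow_eq_zero (w : Laurent k n) (u : Fin (n + 1) → ℤ)
    (hu : ∀ v, (p : ℤ) • v ≠ u) : (w ^ p).coeff u = 0 := by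
  induction w using AddMonoidAlgebra.induction_linear with
  | zero => simp [zero_pow hp.out.ne_zero]
  | add w w' h h' =>
    rw [add_pow_laurent, AddMonoidAlgebra.coeff_add, Finsupp.add_apply, h, h', add_zero]
  | single v c =>
    rw [AddMonoidAlgebra.single_pow, AddMonoidAlgebra.coeff_single, Finsupp.single_apply,
      ← natCast_zsmul, if_neg (hu v)]

/-- The inverse monomial dual to `x ^ m` is `x ^ (-1 - m)`, and its `p`-th power `x ^ (-p - p m)` is
dual to `x ^ (p m + p - 1)`. This explains the formula for `frobDual`. -/
theorem residueDual_pow (w : Laurent k n) :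
    residueDual (w ^ p) = frobDual p (residueDual w) := by
  have hp1 := hp.out.one_le
  refine dual_ext fun m => ?_
  rw [frobDual_monomial, residueDual_monomial, residueDual_monomial, one_mul, one_mul]
  split_ifs with h
  · rw [← coeff_pow_smul]
    congr 1
    funext j
    have h1 := Nat.div_add_mod (m j) p
    rw [h j] at h1
    have h2 : (m j : ℤ) = p * (m j / p : ℕ) + (p - 1) := by
      have h3 := congrArg (Nat.cast : ℕ → ℤ) h1
      push_cast [Nat.cast_sub hp1] at h3 ⊢
      linarith
    simp only [Pi.sub_apply, Pi.neg_apply, Pi.one_apply, intExp_apply, Pi.smul_apply, smul_eq_mul,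
      Finsupp.mapRange_apply]
    rw [h2]
    ring
  · refine coeff_pow_eq_zero p w _ fun v hv => h fun j => ?_
    have h1 := congrFun hv j
    simp only [Pi.sub_apply, Pi.neg_apply, Pi.one_apply, intExp_apply, Pi.smul_apply,
      smul_eq_mul] at h1
    have h2 : ((m j : ℤ)) % p = (p - 1 : ℕ) := by
      rw [Nat.cast_sub hp1, Nat.cast_one, show (m j : ℤ) = (p - 1) + p * (-v j - 1) by linarith,
        Int.add_mul_emod_self_left, Int.emod_eq_of_lt (by omega) (by omega)]
    exact_mod_cast h2

end Frobenius

section Base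

/-- The zero ideal of `S`. -/
abbrev zeroIdeal (k : Type*) [Field k] (n : ℕ) : Ideal (MvPolynomial (Fin (n + 1)) k) := ⊥

/-- The component of a cochain as a Laurent polynomial. -/
def cochainCoeff (α : Cech.Cochain (xbar (zeroIdeal k n))) (s : Finset (Fin (n + 1)))
    (v : Fin (n + 1) → ℤ) : k := (locToLaurent k s (α s)).coeff v

theorem cochainCoeff_d (α : Cech.Cochain (xbar (zeroIdeal k n))) (t : Finset (Fin (n + 1)))
    (v : Fin (n + 1) → ℤ) :
    cochainCoeff (Cech.d _ α) t v = ∑ l ∈ t, Cech.faceSign l t • cochainCoeff α (t.erase l) v :=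
  Cech.map_d_of_res (x := xbar (zeroIdeal k n)) (M := k)
    (fun s => ((Finsupp.applyAddHom v).comp AddMonoidAlgebra.coeffAddEquiv.toAddMonoidHom).comp
      (locToLaurent k s).toAddMonoidHom)
    (fun h z => congrArg (fun w => AddMonoidAlgebra.coeff w v) (locToLaurent_res h z)) α t

theorem laurent_ext {w w' : Laurent k n} (h : ∀ v, w.coeff v = w'.coeff v) : w = w' :=
  AddMonoidAlgebra.ext (Finsupp.ext h)

theorem cochain_ext {α β : Cech.Cochain (xbar (⊥ : Ideal (MvPolynomial (Fin (n + 1)) k)))}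
    (h : ∀ s v, (locToLaurent k s (α s)).coeff v = (locToLaurent k s (β s)).coeff v) : α = β := by
  funext s
  apply locToLaurent_injective s
  apply laurent_ext
  exact h s

theorem cochainCoeff_eq_zero {α : Cech.Cochain (xbar (zeroIdeal k n))} {s : Finset (Fin (n + 1))}
    {v : Fin (n + 1) → ℤ} {j : Fin (n + 1)} (hj : j ∉ s) (hv : v j < 0) :
    cochainCoeff α s v = 0 := by
  by_contra h
  exact hv.not_ge (nonneg_of_coeff_locToLaurent_ne_zero h hj)

/-- If `v j ≥ 0`, then inverting `x_j` makes no difference in multidegree `v`, so removing `j` from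
subsets is a contracting homotopy there. If all `v j` are negative, only the full index set carries
`x ^ v`, and the hypothesis deals with it. For `i < n + 1` that hypothesis is automatic, which
yields the vanishing; for `i = n + 1` it says that the functional is zero. -/
theorem mem_coboundaries_of_cochainCoeff {i : ℕ} {α : Cech.Cochain (xbar (zeroIdeal k n))}
    (hα : α ∈ Cech.cocycles (xbar (zeroIdeal k n)) i)
    (h : ∀ v, (∀ j, v j < 0) → cochainCoeff α Finset.univ v = 0) :
    α ∈ Cech.coboundaries (xbar (zeroIdeal k n)) i := by
  classical
  have hcoc : ∀ (t : Finset (Fin (n + 1))) v,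
      ∑ l ∈ t, Cech.faceSign l t • cochainCoeff α (t.erase l) v = 0 := by
    intro t v
    rw [← cochainCoeff_d, hα.2]
    simp [cochainCoeff]
  -- The homotopy requires a single `j` for all subsets, so the choice depends on `v` alone.
  let u : Finset (Fin (n + 1)) → (Fin (n + 1) → ℤ) → k := fun s v =>
    if hv : ∃ j, 0 ≤ v j then
      if hv.choose ∈ s then 0
      else Cech.faceSign hv.choose (insert hv.choose s) • cochainCoeff α (insert hv.choose s) v
    else 0
  have hu : ∀ s v, u s v ≠ 0 → ∃ j, j ∉ s ∧ 0 ≤ v j ∧ cochainCoeff α (insert j s) v ≠ 0 := by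
    intro s v hne
    simp only [u] at hne
    split_ifs at hne with hv hs
    · exact absurd rfl hne
    · exact ⟨hv.choose, hs, hv.choose_spec, fun h0 => hne (by rw [h0, smul_zero])⟩
    · exact absurd rfl hne
  let w : Finset (Fin (n + 1)) → Laurent k n := fun s => AddMonoidAlgebra.ofCoeff
    (Finsupp.onFinset (Finset.univ.biUnion fun t => (locToLaurent k t (α t)).coeff.support) (u s)
      fun v hne => by
        obtain ⟨j, -, -, hj⟩ := hu s v hne
        exact Finset.mem_biUnion.mpr ⟨_, Finset.mem_univ _, Finsupp.mem_support_iff.mpr hj⟩)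
  have hw : ∀ s v, (w s).coeff v = u s v := fun s v => rfl
  have hex : ∀ s, ∃ z, locToLaurent k s z = w s := by
    intro s
    -- The component of `α` on `insert j s` may have a pole along `x_j`, but only exponents with `v
    -- j ≥ 0` are kept.
    refine exists_locToLaurent_eq fun v hv l hl => ?_
    obtain ⟨j, -, hj, hne⟩ := hu s v hv
    by_cases hlj : l = j
    · exact hlj ▸ hj
    · exact nonneg_of_coeff_locToLaurent_ne_zero hne (by simp [hlj, hl])
  choose z hz using hex
  have hzu : ∀ s v, cochainCoeff z s v = u s v := fun s v => by
    rw [cochainCoeff, hz, hw]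
  refine ⟨z, fun s hs => ?_, cochain_ext fun t v => ?_⟩
  · refine locToLaurent_injective s (laurent_ext fun v => ?_)
    refine (hzu s v).trans ?_
    rw [map_zero]
    by_contra hne
    obtain ⟨j, hj, -, hne'⟩ := hu s v hne
    refine hne' ?_
    rw [cochainCoeff, hα.1 (insert j s) (by rwa [Finset.card_insert_of_notMem hj]), map_zero]
    rfl
  · refine (cochainCoeff_d z t v).trans ?_
    change _ = cochainCoeff α t v
    simp only [hzu, u]
    by_cases hv : ∃ j, 0 ≤ v j
    · simp only [dif_pos hv]
      exact Cech.sum_faceSign_contraction (fun s => cochainCoeff α s v) (fun t => hcoc t v) _ t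
    · simp only [dif_neg hv, smul_zero, Finset.sum_const_zero]
      push Not at hv
      by_cases ht : t = Finset.univ
      · rw [ht, h v hv]
      · obtain ⟨j, hj⟩ : ∃ j, j ∉ t := by simpa [Finset.eq_univ_iff_forall] using ht
        rw [cochainCoeff_eq_zero hj (hv j)]

theorem mem_cocycles_top {α : Cech.Cochain (xbar (zeroIdeal k n))}
    (h : α ∈ Cech.supportedOn (xbar (zeroIdeal k n)) (fun m => m = n + 1)) :
    α ∈ Cech.cocycles (xbar (zeroIdeal k n)) (n + 1) := by
  refine Cech.mem_cocycles.mpr ⟨h, funext fun s => Cech.d_mem_supportedOn h s ?_⟩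
  have := Finset.card_le_univ s
  rw [Fintype.card_fin] at this
  omega

theorem coeff_eq_zero_of_mem_coboundaries {α : Cech.Cochain (xbar (zeroIdeal k n))} {i : ℕ}
    (hα : α ∈ Cech.coboundaries (xbar (zeroIdeal k n)) i) (v : Fin (n + 1) → ℤ)
    (hv : ∀ j, v j < 0) : cochainCoeff α Finset.univ v = 0 := by
  obtain ⟨β, -, rfl⟩ := hα
  rw [cochainCoeff_d]
  refine Finset.sum_eq_zero fun j _ => ?_
  rw [cochainCoeff_eq_zero (Finset.notMem_erase j _) (hv j), smul_zero]

theorem sum_neg_one_sub (d : Fin (n + 1) →₀ ℕ) :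
    ∑ j, (-1 - intExp n d) j = -(n + 1 : ℤ) - d.degree := by
  simp only [Pi.sub_apply, Finset.sum_sub_distrib, sum_intExp]
  simp

theorem exists_residueDual_eq {D : ℤ} {θ : MvPolynomial (Fin (n + 1)) k →ₗ[k] k}
    (hθ : ∀ g, θ (comp D g) = θ g) :
    ∃ w : Laurent k n, residueDual w = θ ∧ (∀ v, w.coeff v ≠ 0 → ∑ j, v j = -(n + 1 : ℤ) - D) := by
  classical
  have hθ' : ∀ d : Fin (n + 1) →₀ ℕ, (d.degree : ℤ) ≠ D → θ (monomial d 1) = 0 := by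
    intro d hd
    rw [← hθ]
    convert map_zero θ
    ext e
    rw [coeff_comp, coeff_monomial, coeff_zero]
    split_ifs with h1 h2
    · exact absurd (h2 ▸ h1) hd
    · rfl
    · rfl
  -- There are finitely many monomials of degree `D`. For negative `D` this is the set of exponents
  -- of degree `0`, which is harmless because `hθ'` makes `θ` vanish there.
  let M : Finset (Fin (n + 1) →₀ ℕ) := Finset.univ.finsuppAntidiag D.toNat
  have hM : ∀ d : Fin (n + 1) →₀ ℕ, d ∈ M ↔ d.degree = D.toNat := by
    intro d
    simp [M, Finset.mem_finsuppAntidiag, Finsupp.degree_eq_sum]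
  let w : Laurent k n := ∑ d ∈ M, AddMonoidAlgebra.single (-1 - intExp n d) (θ (monomial d 1))
  have hw : ∀ v, w.coeff v = ∑ d ∈ M, if -1 - intExp n d = v then θ (monomial d 1) else 0 := by
    intro v
    simp only [w, AddMonoidAlgebra.coeff_sum, Finsupp.finsetSum_apply,
      AddMonoidAlgebra.coeff_single, Finsupp.single_apply]
  refine ⟨w, dual_ext fun d => ?_, fun v hv => ?_⟩
  · rw [residueDual_monomial, one_mul, hw]
    simp only [sub_right_inj, intExp_injective.eq_iff, Finset.sum_ite_eq']
    split_ifs with h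
    · rfl
    · refine (hθ' d fun e => h ((hM d).mpr ?_)).symm
      omega
  · rw [hw] at hv
    obtain ⟨d, -, hd⟩ := Finset.exists_ne_zero_of_sum_ne_zero hv
    split_ifs at hd with h
    · rw [← h, sum_neg_one_sub]
      by_contra hne
      exact hd (hθ' d fun e => hne (by rw [e]))
    · exact absurd rfl hd

variable (k n) in
/-- The presentation of the top local cohomology of `S` by inverse polynomials. -/
theorem nonempty_residuePairing_bot (p : ℕ) [hp : Fact p.Prime] [CharP k p] :
    Nonempty (ResiduePairing p (zeroIdeal k n) (n + 1) (-(n + 1 : ℤ)) 1) := by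
  classical
  refine ⟨{
    vanishing := fun j hj α hα => mem_coboundaries_of_cochainCoeff hα fun v hv => ?_
    toDual := AddMonoidHom.mk' (fun α => residueDual (locToLaurent k Finset.univ (α.1 Finset.univ)))
      fun α β => ?_
    eq_zero_iff := fun α => ?_
    scale := fun g α h => ?_
    surjective := fun D θ _ hθ => ?_
    degree := fun t D α g hα hg hne => ?_
    frob := fun α h => ?_ }⟩
  · rw [cochainCoeff, hα.1 Finset.univ (by simp; omega), map_zero]
    rfl
  · exact (congrArg residueDual (map_add (locToLaurent k Finset.univ) (α.1 Finset.univ)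
      (β.1 Finset.univ))).trans (residueDual_add _ _)
  · change residueDual _ = 0 ↔ _
    rw [residueDual_eq_zero_iff]
    exact ⟨fun h => mem_coboundaries_of_cochainCoeff α.2 h, coeff_eq_zero_of_mem_coboundaries⟩
  · change residueDual (locToLaurent k Finset.univ (Cech.scale _ α.1 Finset.univ)) h =
      residueDual _ (g * h)
    rw [Cech.scale_apply, map_mul, locToLaurent_algebraMap, residueDual_mul]
  · obtain ⟨w, hw, hwd⟩ := exists_residueDual_eq hθ
    obtain ⟨z, hz⟩ := exists_locToLaurent_eq (s := Finset.univ) (w := w)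
      fun v _ j hj => absurd (Finset.mem_univ j) hj
    have hsupp : (Pi.single Finset.univ z : Cech.Cochain (xbar (zeroIdeal k n))) ∈
        Cech.supportedOn (xbar (zeroIdeal k n)) (fun m => m = n + 1) := by
      intro s hs
      refine Pi.single_eq_of_ne (fun h => hs ?_) _
      rw [h]
      simp
    have hdeg : ∀ s, (Pi.single Finset.univ z : Cech.Cochain (xbar (zeroIdeal k n))) s ∈
        locDeg (zeroIdeal k n) s (-(n + 1 : ℤ) - D) := by
      intro s
      by_cases hs : s = Finset.univ
      · subst hs
        rw [Pi.single_eq_same]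
        exact mem_locDeg_bot_iff.mpr fun v hv => hwd v (hz ▸ hv)
      · rw [Pi.single_eq_of_ne hs]
        exact zero_mem _
    refine ⟨⟨_, mem_cocycles_top hsupp⟩, mem_cochainDeg.mpr hdeg, ?_⟩
    · change residueDual (locToLaurent k Finset.univ (Pi.single Finset.univ z Finset.univ)) = θ
      rw [Pi.single_eq_same, hz, hw]
  · change residueDual _ g = 0
    rw [residueDual_eq_sum]
    refine Finset.sum_eq_zero fun d hd => ?_
    by_contra h
    have h1 := mem_polyDeg.mp hg d (left_ne_zero_of_mul h)
    have h2 := mem_locDeg_bot_iff.mp (mem_cochainDeg.mp hα Finset.univ) _ (right_ne_zero_of_mul h)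
    rw [sum_neg_one_sub] at h2
    exact hne (by linarith)
  · change residueDual (locToLaurent k Finset.univ ((α.1 Finset.univ) ^ p)) h = frobDual p _ _
    rw [map_pow, residueDual_pow, one_pow, one_mul]
    rfl

end Base

end Graded

end

/-! ### Regular sequences: the dimension of the quotient and the induction on their length. -/

noncomputable section

namespace Graded

open MvPolynomial

section RegularSequence

variable {S : Type*} [CommRing S] {c : ℕ}

theorem ofList_ofFn (f : Fin c → S) : Ideal.ofList (List.ofFn f) = Ideal.span (Set.range f) := by
  rw [Ideal.ofList]
  congr 1
  ext g
  simp [List.mem_ofFn]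

theorem span_range_castSucc_sup (f : Fin (c + 1) → S) :
    Ideal.span (Set.range f) =
      Ideal.span (Set.range fun i : Fin c => f i.castSucc) ⊔ Ideal.span {f (Fin.last c)} := by
  rw [← Ideal.span_union]
  congr 1
  ext g
  simp only [Set.mem_range, Set.mem_union, Set.mem_singleton_iff]
  constructor
  · rintro ⟨i, rfl⟩
    induction i using Fin.lastCases with
    | last => exact Or.inr rfl
    | cast i => exact Or.inl ⟨i, rfl⟩
  · rintro (⟨i, rfl⟩ | rfl)
    exacts [⟨_, rfl⟩, ⟨_, rfl⟩]

theorem isWeaklyRegular_ofFn_succ {f : Fin (c + 1) → S}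
    (h : RingTheory.Sequence.IsWeaklyRegular S (List.ofFn f)) :
    RingTheory.Sequence.IsWeaklyRegular S (List.ofFn fun i : Fin c => f i.castSucc) ∧
      ∀ g, f (Fin.last c) * g ∈ Ideal.span (Set.range fun i : Fin c => f i.castSucc) →
        g ∈ Ideal.span (Set.range fun i : Fin c => f i.castSucc) := by
  rw [List.ofFn_succ', List.concat_eq_append,
    RingTheory.Sequence.isWeaklyRegular_append_iff,
    RingTheory.Sequence.isWeaklyRegular_singleton_iff] at h
  refine ⟨h.1, fun g hg => ?_⟩
  have e : Ideal.ofList (List.ofFn fun i : Fin c => f i.castSucc) • (⊤ : Submodule S S) =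
      Ideal.span (Set.range fun i : Fin c => f i.castSucc) := by
    rw [ofList_ofFn, smul_eq_mul, Ideal.mul_top]
  have h2 := h.2
  rw [← e] at hg ⊢
  rw [← Submodule.Quotient.mk_eq_zero] at hg ⊢
  refine h2 ?_
  simp only [smul_zero]
  rw [← Submodule.Quotient.mk_smul]
  exact hg

theorem ringKrullDim_quotient_add_le {f : Fin c → S}
    (h : RingTheory.Sequence.IsWeaklyRegular S (List.ofFn f)) :
    ringKrullDim (S ⧸ Ideal.span (Set.range f)) + c ≤ ringKrullDim S := by
  induction c with
  | zero =>
    rw [Nat.cast_zero, add_zero]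
    exact ringKrullDim_quotient_le _
  | succ c ih =>
    obtain ⟨h1, h2⟩ := isWeaklyRegular_ofFn_succ h
    have hle : Ideal.span (Set.range fun i : Fin c => f i.castSucc) ≤ Ideal.span (Set.range f) := by
      rw [span_range_castSucc_sup f]
      exact le_sup_left
    refine le_trans ?_ (ih h1)
    rw [Nat.cast_succ, add_comm (c : WithBot ℕ∞) 1, ← add_assoc]
    refine add_le_add_left ?_ _
    refine ringKrullDim_succ_le_of_surjective (Ideal.Quotient.factor hle)
      (Ideal.Quotient.factor_surjective hle)
      (r := Ideal.Quotient.mk _ (f (Fin.last c))) ?_ ?_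
    · rw [mem_nonZeroDivisors_iff_right]
      intro a ha
      obtain ⟨g, rfl⟩ := Ideal.Quotient.mk_surjective a
      rw [← map_mul, mul_comm] at ha
      exact Ideal.Quotient.eq_zero_iff_mem.mpr (h2 g (Ideal.Quotient.eq_zero_iff_mem.mp ha))
    · exact Ideal.Quotient.eq_zero_iff_mem.mpr (Ideal.subset_span ⟨_, rfl⟩)

end RegularSequence

variable {k : Type*} [Field k] {n : ℕ}

theorem isMaximal_ker_constantCoeff (σ : Type*) :
    (RingHom.ker (constantCoeff : MvPolynomial σ k →+* k)).IsMaximal :=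
  RingHom.ker_isMaximal_of_surjective _ fun c => ⟨C c, constantCoeff_C _ c⟩

/-- Induction on the number of variables: a maximal ideal of `B[X]` lying over a maximal ideal of a
Noetherian ring `B` has height one more. -/
theorem height_ker_constantCoeff (m : ℕ) :
    (RingHom.ker (constantCoeff : MvPolynomial (Fin m) k →+* k)).height = m := by
  induction m with
  | zero =>
    have : RingHom.ker (constantCoeff : MvPolynomial (Fin 0) k →+* k) = ⊥ := by
      rw [eq_bot_iff]
      intro g hg
      rw [RingHom.mem_ker] at hg
      rw [Submodule.mem_bot, eq_C_of_isEmpty g, ← constantCoeff_eq, hg, C_0]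
    rw [this]
    simp
  | succ m ih =>
    let e := (finSuccEquiv k m).toRingEquiv
    let P : Ideal (Polynomial (MvPolynomial (Fin m) k)) :=
      RingHom.ker ((constantCoeff : MvPolynomial (Fin m) k →+* k).comp Polynomial.constantCoeff)
    have hPmax : P.IsMaximal := RingHom.ker_isMaximal_of_surjective _ fun c =>
      ⟨Polynomial.C (C c), by simp⟩
    have hmax := isMaximal_ker_constantCoeff (k := k) (Fin m)
    have hover : P.LiesOver (RingHom.ker (constantCoeff : MvPolynomial (Fin m) k →+* k)) := by
      constructor
      ext g
      simp [P, Ideal.under, RingHom.mem_ker]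
    have hcomap : P.comap e = RingHom.ker (constantCoeff : MvPolynomial (Fin (m + 1)) k →+* k) := by
      have : ((constantCoeff : MvPolynomial (Fin m) k →+* k).comp Polynomial.constantCoeff).comp
          (e : _ →+* _) = (constantCoeff : MvPolynomial (Fin (m + 1)) k →+* k) := by
        refine MvPolynomial.ringHom_ext (fun c => ?_) fun j => ?_
        · simp [e, finSuccEquiv_apply]
        · refine Fin.cases ?_ (fun j => ?_) j
          · simp [e, finSuccEquiv_X_zero]
          · simp [e, finSuccEquiv_X_succ]
      rw [← this]
      rfl
    rw [← hcomap, e.height_comap, Polynomial.height_eq_height_add_one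
      (RingHom.ker (constantCoeff : MvPolynomial (Fin m) k →+* k)) P, ih]
    rfl

theorem mem_irrelevant {g : MvPolynomial (Fin (n + 1)) k} :
    g ∈ irrelevant k n ↔ coeff 0 g = 0 := by
  have := mem_pow_idealOfVars_iff' 1 g
  rw [pow_one] at this
  refine this.trans ⟨fun h => h 0 (by simp), fun h d hd => ?_⟩
  have : d = 0 := (Finsupp.degree_eq_zero_iff d).mp (by omega)
  rw [this, h]

theorem irrelevant_eq_ker : irrelevant k n =
    RingHom.ker (constantCoeff : MvPolynomial (Fin (n + 1)) k →+* k) := by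
  ext g
  rw [mem_irrelevant, RingHom.mem_ker, constantCoeff_eq]

/-- Proper homogeneous ideals are contained in the irrelevant ideal. -/
theorem le_irrelevant {I : Ideal (MvPolynomial (Fin (n + 1)) k)}
    (hI : ∀ g ∈ I, ∀ m, homogeneousComponent m g ∈ I) (hne : I ≠ ⊤) : I ≤ irrelevant k n := by
  intro g hg
  rw [mem_irrelevant]
  by_contra h
  have h1 := hI g hg 0
  rw [homogeneousComponent_zero] at h1
  exact hne (Ideal.eq_top_of_isUnit_mem _ h1 ((isUnit_iff_ne_zero.mpr h).map C))

variable {c : ℕ} {f : Fin c → MvPolynomial (Fin (n + 1)) k} {e : Fin c → ℕ}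

theorem homogeneousComponent_mem_span_range (hf : ∀ i, (f i).IsHomogeneous (e i)) :
    ∀ g ∈ Ideal.span (Set.range f), ∀ m, homogeneousComponent m g ∈ Ideal.span (Set.range f) := by
  refine homogeneousComponent_mem_span ?_
  rintro _ ⟨i, rfl⟩
  exact ⟨e i, hf i⟩

/-- Each nonzerodivisor lowers the dimension by at least one. Conversely `J ⊆ 𝔪` has at most `c`
generators and `𝔪` has height `n + 1`, so the dimension is at least `n + 1 - c`. This matches the
`dim` in `aInvariant` with the cohomological degree `n + 1 - c`. -/
theorem ringKrullDim_quotient_regular (hf : ∀ i, (f i).IsHomogeneous (e i))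
    (hreg : RingTheory.Sequence.IsWeaklyRegular (MvPolynomial (Fin (n + 1)) k) (List.ofFn f))
    (hne : Ideal.span (Set.range f) ≠ ⊤) :
    c ≤ n + 1 ∧ dim (Ideal.span (Set.range f)) = n + 1 - c := by
  have h1 := ringKrullDim_quotient_add_le hreg
  have hS : ringKrullDim (MvPolynomial (Fin (n + 1)) k) = ((n + 1 : ℕ) : WithBot ℕ∞) := by
    rw [MvPolynomial.ringKrullDim_of_isNoetherianRing, ringKrullDim_eq_zero_of_field]
    simp
  have hle := le_irrelevant (homogeneousComponent_mem_span_range hf) hne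
  have hmax := isMaximal_ker_constantCoeff (k := k) (Fin (n + 1))
  rw [irrelevant_eq_ker] at hle
  have h2 := height_le_ringKrullDim_quotient_add_spanFinrank hle
  rw [height_ker_constantCoeff] at h2
  have h3 : (Ideal.span (Set.range f)).spanFinrank ≤ c := by
    refine (Submodule.spanFinrank_span_le_ncard_of_finite (Set.finite_range f)).trans ?_
    rw [← Set.image_univ]
    refine (Set.ncard_image_le Set.finite_univ).trans ?_
    simp
  have : Nontrivial (MvPolynomial (Fin (n + 1)) k ⧸ Ideal.span (Set.range f)) :=
    Ideal.Quotient.nontrivial_iff.mpr hne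
  rw [hS] at h1
  rw [dim]
  have h0 := ringKrullDim_nonneg_of_nontrivial
    (R := MvPolynomial (Fin (n + 1)) k ⧸ Ideal.span (Set.range f))
  generalize ringKrullDim (MvPolynomial (Fin (n + 1)) k ⧸ Ideal.span (Set.range f)) = r at *
  generalize (Ideal.span (Set.range f)).spanFinrank = q at *
  cases r with
  | bot => simp at h0
  | coe r =>
    cases r with
    | top =>
      have h4 : ((⊤ + c : ℕ∞) : WithBot ℕ∞) ≤ ((n + 1 : ℕ) : ℕ∞) := h1
      rw [WithBot.coe_le_coe, top_add, top_le_iff] at h4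
      exact absurd h4 (ENat.natCast_ne_top _)
    | coe r =>
      have h1' : r + c ≤ n + 1 := by exact_mod_cast h1
      have h2' : n + 1 ≤ r + q := by exact_mod_cast h2
      refine ⟨by omega, ?_⟩
      have : ((((r : ℕ∞) : WithBot ℕ∞)).unbotD 0).toNat = r := rfl
      rw [this]
      omega

theorem nonempty_residuePairing (p : ℕ) [Fact p.Prime] [CharP k p] {c : ℕ} (hc : c ≤ n + 1)
    {f : Fin c → MvPolynomial (Fin (n + 1)) k} {e : Fin c → ℕ}
    (hf : ∀ i, (f i).IsHomogeneous (e i))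
    (hreg : RingTheory.Sequence.IsWeaklyRegular (MvPolynomial (Fin (n + 1)) k) (List.ofFn f)) :
    Nonempty (ResiduePairing p (Ideal.span (Set.range f)) (n + 1 - c)
      (∑ i, (e i : ℤ) - (n + 1)) (∏ i, f i)) := by
  induction c with
  | zero =>
    have h1 : Ideal.span (Set.range f) = zeroIdeal k n := by
      rw [Set.range_eq_empty, Ideal.span_empty]
    rw [h1]
    simpa using nonempty_residuePairing_bot k n p
  | succ c ih =>
    obtain ⟨h1, h2⟩ := isWeaklyRegular_ofFn_succ hreg
    obtain ⟨P⟩ := ih (by omega) (fun i => hf i.castSucc) h1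
    -- The truncated subtraction is exact here because `c + 1 ≤ n + 1`.
    have h3 : n + 1 - c = n + 1 - (c + 1) + 1 := by omega
    rw [h3] at P
    have h4 := P.nonempty_quotient
      (homogeneousComponent_mem_span_range fun i : Fin c => hf i.castSucc) (hf (Fin.last c)) h2
      (span_range_castSucc_sup f)
    rw [Fin.prod_univ_castSucc, Fin.sum_univ_castSucc]
    convert h4 using 2
    ring

end Graded

end

noncomputable section

/-! ### Cartier maps on a polynomial ring -/

namespace Graded

open MvPolynomial

universe u

/-- A basis with its coordinate functions. The basis may be infinite, so the expansion is stated on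
finite sets of vectors; this allows fields of infinite degree over their `p`-th powers. -/
theorem exists_dual_family (K : Type*) (V : Type u) [Field K] [AddCommGroup V] [Module K V] :
    ∃ (ι : Type u) (b : ι → V) (ψ : ι → V →+ K), (∀ i (a : K) v, ψ i (a • v) = a * ψ i v) ∧
      ∀ T : Finset V, ∃ s : Finset ι, ∀ v ∈ T, ∑ i ∈ s, ψ i v • b i = v := by
  classical
  let B := Module.Basis.ofVectorSpace K V
  refine ⟨_, B, fun i => (B.coord i).toAddMonoidHom, fun i a v => (B.coord i).map_smul a v,
    fun T => ⟨T.biUnion fun v => (B.repr v).support, fun v hv => ?_⟩⟩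
  conv_rhs => rw [← B.linearCombination_repr v, Finsupp.linearCombination_apply]
  exact (Finsupp.sum_of_support_subset _
    (Finset.subset_biUnion_of_mem (fun v => (B.repr v).support) hv)
    (fun i a => a • B i) fun i _ => zero_smul K _).symm

variable {k : Type*} [Field k] (p : ℕ)

/-- An additive map `ψ : k → k` is inverse Frobenius linear if `ψ (a ^ p b) = a ψ(b)`. -/
def IsInverseFrobLinear (ψ : k →+ k) : Prop := ∀ a b, ψ (a ^ p * b) = a * ψ b

/-- For `k` as a module over itself through Frobenius, `a • v` is `a ^ p * v`, so coordinate
functions are inverse Frobenius linear. -/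
theorem exists_inverseFrobLinear_dual_family (k : Type u) [Field k] [Fact p.Prime] [CharP k p] :
    ∃ (ι : Type u) (b : ι → k) (ψ : ι → k →+ k), (∀ i, IsInverseFrobLinear p (ψ i)) ∧
      ∀ T : Finset k, ∃ s : Finset ι, ∀ v ∈ T, ∑ i ∈ s, ψ i v ^ p * b i = v :=
  @exists_dual_family k k _ _ (Module.compHom k (frobenius k p))

theorem eq_zero_of_inverseFrobLinear [Fact p.Prime] [CharP k p] {a : k}
    (h : ∀ ψ : k →+ k, IsInverseFrobLinear p ψ → ψ a = 0) : a = 0 := by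
  obtain ⟨ι, b, ψ, hψ, hb⟩ := exists_inverseFrobLinear_dual_family p k
  obtain ⟨s, hs⟩ := hb {a}
  rw [← hs a (Finset.mem_singleton_self a)]
  refine Finset.sum_eq_zero fun i _ => ?_
  rw [h _ (hψ i), zero_pow (Fact.out : p.Prime).ne_zero, zero_mul]

variable {σ : Type*}

/-- The exponents of `x ^ d` divided by `p`, rounded down. -/
abbrev expDiv (d : σ →₀ ℕ) : σ →₀ ℕ := d.mapRange (· / p) (Nat.zero_div p)

/-- The exponents of `x ^ d` modulo `p`. -/
abbrev expMod (d : σ →₀ ℕ) : σ →₀ ℕ := d.mapRange (· % p) (Nat.zero_mod p)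

theorem smul_expDiv_add_expMod (d : σ →₀ ℕ) : p • expDiv p d + expMod p d = d := by
  ext j
  simpa using Nat.div_add_mod (d j) p

section

variable (ψ : k →+ k) (r : σ →₀ ℕ)

open Classical in
theorem sum_cartier_eq {g : MvPolynomial σ k} {T : Finset (σ →₀ ℕ)} (h : g.support ⊆ T) :
    ∑ d ∈ g.support, (if expMod p d = r then monomial (expDiv p d) (ψ (coeff d g)) else 0) =
    ∑ d ∈ T, (if expMod p d = r then monomial (expDiv p d) (ψ (coeff d g)) else 0) := by
  refine Finset.sum_subset h fun d _ hd => ?_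
  rw [notMem_support_iff.mp hd]
  simp

open Classical in
/-- The Cartier map on `k[x]` attached to `ψ : k → k` and `r`: it sends `c x ^ (p m + r)` to
`ψ(c) x ^ m` and `c x ^ d` to zero if `d` is not congruent to `r` modulo `p`. -/
def cartier : MvPolynomial σ k →+ MvPolynomial σ k where
  toFun g := ∑ d ∈ g.support, if expMod p d = r then monomial (expDiv p d) (ψ (coeff d g)) else 0
  map_zero' := by simp
  map_add' g h := by
    rw [sum_cartier_eq p ψ r (support_add (p := g) (q := h)),
      sum_cartier_eq p ψ r (Finset.subset_union_left (s₁ := g.support) (s₂ := h.support)),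
      sum_cartier_eq p ψ r (Finset.subset_union_right (s₁ := g.support) (s₂ := h.support)),
      ← Finset.sum_add_distrib]
    refine Finset.sum_congr rfl fun d _ => ?_
    split_ifs
    · rw [coeff_add, map_add, map_add]
    · rw [add_zero]

open Classical in
theorem cartier_apply (g : MvPolynomial σ k) : cartier p ψ r g =
    ∑ d ∈ g.support, if expMod p d = r then monomial (expDiv p d) (ψ (coeff d g)) else 0 := rfl

open Classical in
theorem cartier_monomial (d : σ →₀ ℕ) (c : k) : cartier p ψ r (monomial d c) =
    if expMod p d = r then monomial (expDiv p d) (ψ c) else 0 := by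
  rw [cartier_apply, sum_cartier_eq p ψ r (T := {d}) support_monomial_subset,
    Finset.sum_singleton, coeff_monomial, if_pos rfl]

variable {ψ}

theorem cartier_pow_mul [hp : Fact p.Prime] [CharP k p] (hψ : IsInverseFrobLinear p ψ)
    (a g : MvPolynomial σ k) : cartier p ψ r (a ^ p * g) = a * cartier p ψ r g := by
  classical
  induction a using MvPolynomial.induction_on' with
  | add a b ha hb => rw [add_pow_char, add_mul, add_mul, map_add, ha, hb]
  | monomial e a =>
    induction g using MvPolynomial.induction_on' with
    | add g h hg hh => rw [mul_add, map_add, map_add, mul_add, hg, hh]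
    | monomial d c =>
      have h1 : expMod p (p • e + d) = expMod p d := by
        ext j
        simp
      have h2 : expDiv p (p • e + d) = e + expDiv p d := by
        ext j
        simp [Nat.mul_add_div hp.out.pos]
      rw [monomial_pow, monomial_mul, cartier_monomial, cartier_monomial, h1, h2, hψ]
      split_ifs
      · rw [monomial_mul]
      · rw [mul_zero]

theorem isHomogeneous_cartier (hp : p ≠ 0) {g : MvPolynomial σ k} {m : ℕ} (hg : g.IsHomogeneous m) :
    ∃ l, (cartier p ψ r g).IsHomogeneous l := by
  classical
  refine ⟨(m - r.degree) / p, ?_⟩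
  rw [cartier_apply]
  refine IsHomogeneous.sum _ _ _ fun d hd => ?_
  split_ifs with h
  · refine isHomogeneous_monomial _ ?_
    have h1 : d.degree = m := (hg.degree_eq_sum_deg_support hd).symm
    rw [← smul_expDiv_add_expMod p d, h, map_add, map_nsmul] at h1
    rw [← h1, Nat.add_sub_cancel, smul_eq_mul, Nat.mul_div_cancel_left _ (Nat.pos_of_ne_zero hp)]
  · exact isHomogeneous_zero _ _ _

theorem cartier_mem_of_mem_frobPower [Fact p.Prime] [CharP k p] (hψ : IsInverseFrobLinear p ψ)
    {I : Ideal (MvPolynomial σ k)} {g : MvPolynomial σ k} (hg : g ∈ frobPower p I) :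
    cartier p ψ r g ∈ I := by
  -- Cartier maps are not `S`-linear, so the multiplier `s` has to be carried through the induction.
  suffices h : ∀ s, cartier p ψ r (s * g) ∈ I by simpa using h 1
  refine Submodule.span_induction ?_ ?_ ?_ ?_ hg
  · rintro _ ⟨a, ha, rfl⟩ s
    rw [mul_comm, cartier_pow_mul p r hψ]
    exact I.mul_mem_right _ ha
  · intro s
    rw [mul_zero, map_zero]
    exact zero_mem _
  · intro x y _ _ hx hy s
    rw [mul_add, map_add]
    exact add_mem (hx s) (hy s)
  · intro t x _ hx s
    rw [smul_eq_mul, ← mul_assoc]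
    exact hx _

end

/-- The ideal generated by the images of `g` under all Cartier maps. It is the smallest ideal `I`
with `g ∈ I ^ [p]`. -/
def cartierIdeal (g : MvPolynomial σ k) : Ideal (MvPolynomial σ k) :=
  Ideal.span {h | ∃ (ψ : k →+ k) (r : σ →₀ ℕ), IsInverseFrobLinear p ψ ∧ cartier p ψ r g = h}

theorem cartierIdeal_le [Fact p.Prime] [CharP k p] {I : Ideal (MvPolynomial σ k)}
    {g : MvPolynomial σ k} (hg : g ∈ frobPower p I) : cartierIdeal p g ≤ I := by
  rw [cartierIdeal, Ideal.span_le]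
  rintro _ ⟨ψ, r, hψ, rfl⟩
  exact cartier_mem_of_mem_frobPower p r hψ hg

/-- The elements `b_i x ^ r` with all entries of `r` below `p` span `S` over its `p`-th powers, and
Cartier maps are the coordinates: `g` is the sum of `cartier p (ψ i) r g ^ p * b_i x ^ r`. -/
theorem mem_frobPower_cartierIdeal [hp : Fact p.Prime] [CharP k p] (g : MvPolynomial σ k) :
    g ∈ frobPower p (cartierIdeal p g) := by
  classical
  obtain ⟨ι, b, ψ, hψ, hb⟩ := exists_inverseFrobLinear_dual_family p k
  obtain ⟨s, hs⟩ := hb (g.support.image fun d => coeff d g)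
  set R := g.support.image (expMod p) with hR
  -- The expansion as an additive map, so that `Φ g = g` can be checked on the terms of `g`.
  let Φ : MvPolynomial σ k →+ MvPolynomial σ k :=
    ∑ i ∈ s, ∑ r ∈ R, (AddMonoidHom.mulRight (monomial r (b i))).comp
      ((frobenius (MvPolynomial σ k) p).toAddMonoidHom.comp (cartier p (ψ i) r))
  have hΦ (h) : Φ h = ∑ i ∈ s, ∑ r ∈ R, cartier p (ψ i) r h ^ p * monomial r (b i) := by
    simp [Φ, frobenius_def]
  have key : Φ g = g := by
    conv_lhs => rw [g.as_sum, map_sum]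
    conv_rhs => rw [g.as_sum]
    refine Finset.sum_congr rfl fun d hd => ?_
    rw [hΦ]
    have h1 (i : ι) : ∑ r ∈ R, cartier p (ψ i) r (monomial d (coeff d g)) ^ p * monomial r (b i) =
        monomial d (ψ i (coeff d g) ^ p * b i) := by
      rw [Finset.sum_eq_single (expMod p d)]
      · rw [cartier_monomial, if_pos rfl, monomial_pow, monomial_mul, smul_expDiv_add_expMod]
      · intro r _ hr
        rw [cartier_monomial, if_neg hr.symm, zero_pow hp.out.ne_zero, zero_mul]
      · intro h
        exact absurd (Finset.mem_image_of_mem _ hd) h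
    rw [Finset.sum_congr rfl fun i _ => h1 i, ← map_sum,
      hs _ (Finset.mem_image_of_mem (fun d => coeff d g) hd)]
  suffices h2 : Φ g ∈ frobPower p (cartierIdeal p g) by rwa [key] at h2
  rw [hΦ]
  refine Ideal.sum_mem _ fun i _ => Ideal.sum_mem _ fun r _ => Ideal.mul_mem_right _ _ ?_
  exact Ideal.subset_span ⟨_, Ideal.subset_span ⟨ψ i, r, hψ i, rfl⟩, rfl⟩

section Dual

variable {n : ℕ} [Fact p.Prime]

/-- Adjointness of Frobenius and Cartier maps. As `r + l` is constantly `p - 1`, the exponent `d + p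
m + l` is congruent to `p - 1` exactly when `d` is congruent to `r`, and its quotient by `p` is then
that of `d` plus `m`. -/
theorem apply_frobDual_mul_monomial {ψ : k →+ k} (hψ : IsInverseFrobLinear p ψ)
    (θ : MvPolynomial (Fin (n + 1)) k →ₗ[k] k) (g : MvPolynomial (Fin (n + 1)) k)
    {m r l : Fin (n + 1) →₀ ℕ} (hl : ∀ j, r j + l j = p - 1) :
    ψ (frobDual p θ (g * monomial (p • m + l) 1)) = θ (cartier p ψ r g * monomial m 1) := by
  classical
  have hpos := (Fact.out : p.Prime).pos
  induction g using MvPolynomial.induction_on' with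
  | add g h hg hh => rw [add_mul, map_add, map_add, map_add, add_mul, map_add, hg, hh]
  | monomial d c =>
    have h0 : (monomial d c : MvPolynomial (Fin (n + 1)) k) * monomial (p • m + l) 1 =
        c • monomial (d + (p • m + l)) 1 := by
      rw [monomial_mul, smul_monomial, smul_eq_mul]
    have hmod : (∀ j, (d + (p • m + l)) j % p = p - 1) ↔ expMod p d = r := by
      rw [Finsupp.ext_iff]
      refine forall_congr' fun j => ?_
      have h1 := hl j
      have h2 := Nat.div_add_mod (d j) p
      have h3 := Nat.mod_lt (d j) hpos
      simp only [Finsupp.add_apply, Finsupp.smul_apply, smul_eq_mul, Finsupp.mapRange_apply]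
      have h4 : (d j + (p * m j + l j)) % p = (d j % p + l j) % p := by
        conv_lhs => rw [← h2, show p * (d j / p) + d j % p + (p * m j + l j) =
          (d j % p + l j) + p * (d j / p + m j) by ring, Nat.add_mul_mod_self_left]
      rw [h4]
      constructor
      · intro h5
        rcases lt_or_ge (d j % p + l j) p with h6 | h6
        · rw [Nat.mod_eq_of_lt h6] at h5
          omega
        · rw [Nat.mod_eq_sub_mod h6, Nat.mod_eq_of_lt (by omega)] at h5
          omega
      · intro h5
        rw [h5, h1, Nat.mod_eq_of_lt (by omega)]
    rw [h0, map_smul, smul_eq_mul, frobDual_monomial, cartier_monomial]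
    simp only [hmod]
    split_ifs with h
    · have hdiv : Finsupp.mapRange (· / p) (Nat.zero_div p) (d + (p • m + l)) = expDiv p d + m := by
        ext j
        have h1 := hl j
        have h2 := Nat.div_add_mod (d j) p
        have h3 := DFunLike.congr_fun h j
        simp only [Finsupp.mapRange_apply] at h3
        simp only [Finsupp.add_apply, Finsupp.smul_apply, smul_eq_mul, Finsupp.mapRange_apply]
        rw [Nat.div_eq_iff hpos, add_mul]
        have h4 := mul_comm (d j / p) p
        have h5 := mul_comm (m j) p
        constructor <;> omega
      rw [hdiv, mul_comm, hψ, monomial_mul, mul_one]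
      rw [show monomial (expDiv p d + m) (ψ c) = ψ c • monomial (expDiv p d + m) (1 : k) by
        rw [smul_monomial, smul_eq_mul, mul_one], map_smul, smul_eq_mul, mul_comm]
    · rw [mul_zero, map_zero, zero_mul, map_zero]

/-- A functional vanishes on the ideal generated by the Cartier images of `g` if and only if `g`
annihilates its Frobenius twist. -/
theorem frobDual_mul_eq_zero_iff [CharP k p] (θ : MvPolynomial (Fin (n + 1)) k →ₗ[k] k)
    (g : MvPolynomial (Fin (n + 1)) k) :
    (∀ h, frobDual p θ (g * h) = 0) ↔ ∀ h ∈ cartierIdeal p g, θ h = 0 := by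
  have hpos := (Fact.out : p.Prime).pos
  constructor
  · intro H h hh
    suffices h2 : ∀ s, θ (h * s) = 0 by simpa using h2 1
    refine Submodule.span_induction ?_ ?_ ?_ ?_ hh
    · rintro _ ⟨ψ, r, hψ, rfl⟩ s
      have h3 : θ ∘ₗ LinearMap.mulLeft k (cartier p ψ r g) = 0 := dual_ext fun m => by
        rw [LinearMap.comp_apply, LinearMap.mulLeft_apply, LinearMap.zero_apply]
        -- If some entry of `r` is at least `p`, no exponent reduces to `r` and the Cartier map is
        -- zero.
        by_cases hr : ∀ j, r j < p
        · rw [← apply_frobDual_mul_monomial p hψ θ g (m := m) (r := r)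
            (l := Finsupp.equivFunOnFinite.symm fun j => p - 1 - r j), H, map_zero]
          intro j
          have := hr j
          simp only [Finsupp.equivFunOnFinite_symm_apply_apply]
          omega
        · rw [cartier_apply, Finset.sum_eq_zero, zero_mul, map_zero]
          intro d _
          refine if_neg fun h4 => hr fun j => ?_
          rw [← h4]
          exact Nat.mod_lt _ hpos
      exact LinearMap.congr_fun h3 s
    · intro s
      rw [zero_mul, map_zero]
    · intro x y _ _ hx hy s
      rw [add_mul, map_add, hx, hy, add_zero]
    · intro t x _ hx s
      rw [smul_eq_mul, mul_comm t, mul_assoc, hx]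
  · intro H h
    have h3 : frobDual p θ ∘ₗ LinearMap.mulLeft k g = 0 := dual_ext fun m' => by
      rw [LinearMap.comp_apply, LinearMap.mulLeft_apply, LinearMap.zero_apply]
      -- Inverse Frobenius linear maps detect zero in `k`; under each of them adjointness turns the
      -- value into one of `θ` on the Cartier ideal.
      refine eq_zero_of_inverseFrobLinear p fun ψ hψ => ?_
      rw [← smul_expDiv_add_expMod p m', apply_frobDual_mul_monomial p hψ θ g
        (r := Finsupp.equivFunOnFinite.symm fun j => p - 1 - m' j % p)]
      · exact H _ (Ideal.mul_mem_right _ _ (Ideal.subset_span ⟨ψ, _, hψ, rfl⟩))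
      · intro j
        have := Nat.mod_lt (m' j) hpos
        simp only [Finsupp.equivFunOnFinite_symm_apply_apply, Finsupp.mapRange_apply]
        omega
    exact LinearMap.congr_fun h3 h

end Dual

end Graded

end

/-! ### The kernel of Frobenius as the graded dual of `S/τ`. -/

noncomputable section

namespace Graded

open MvPolynomial

variable {k : Type*} [Field k] {n : ℕ}

theorem exists_apply_comp_ne_zero {M : Type*} [AddCommMonoid M] [Module k M]
    (θ : MvPolynomial (Fin (n + 1)) k →ₗ[k] M) {g : MvPolynomial (Fin (n + 1)) k} (h : θ g ≠ 0) :
    ∃ m : ℕ, θ (comp (m : ℤ) g) ≠ 0 := by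
  by_contra! H
  refine h ?_
  rw [← sum_homogeneousComponent g, map_sum]
  exact Finset.sum_eq_zero fun m _ => by rw [← comp_natCast]; exact H m

theorem quotDeg_eq_bot_iff {I : Ideal (MvPolynomial (Fin (n + 1)) k)} {t : ℤ} :
    quotDeg I t = ⊥ ↔ ∀ g ∈ polyDeg k n t, g ∈ I := by
  rw [eq_bot_iff]
  constructor
  · intro h g hg
    exact Ideal.Quotient.eq_zero_iff_mem.mp (h (mk_mem_quotDeg hg))
  · rintro h _ ⟨g, hg, rfl⟩
    exact Ideal.Quotient.eq_zero_iff_mem.mpr (h g hg)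

/-- For an `𝔪`-primary ideal `I`, the maximum defining `reg (S/I)` exists. -/
theorem isGreatest_reg_quotDeg {I : Ideal (MvPolynomial (Fin (n + 1)) k)}
    (hI : I.radical = irrelevant k n) :
    IsGreatest {t | quotDeg I t ≠ ⊥} (reg (quotDeg I)) := by
  have hne : (1 : MvPolynomial (Fin (n + 1)) k) ∉ I := fun h => by
    have h1 := Ideal.le_radical h
    rw [hI, mem_irrelevant, coeff_zero_one] at h1
    exact one_ne_zero h1
  obtain ⟨N, hN⟩ := I.exists_radical_pow_le_of_fg (IsNoetherian.noetherian _)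
  rw [hI] at hN
  have hbdd : BddAbove {t | quotDeg I t ≠ ⊥} := by
    refine ⟨N, fun t ht => ?_⟩
    by_contra! hlt
    refine ht (quotDeg_eq_bot_iff.mpr fun g hg => hN ((mem_pow_idealOfVars_iff' N g).mpr ?_))
    intro d hd
    by_contra h
    have := mem_polyDeg.mp hg d h
    omega
  refine ⟨Int.csSup_mem ⟨0, fun h => hne (quotDeg_eq_bot_iff.mp h 1 ?_)⟩ hbdd,
    fun t ht => le_csSup hbdd ht⟩
  exact isHomogeneous_iff_mem_polyDeg.mp (isHomogeneous_one _ _)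

theorem mem_lcDeg {I : Ideal (MvPolynomial (Fin (n + 1)) k)} {i : ℕ} {t : ℤ} {y : LC I i} :
    y ∈ lcDeg I i t ↔ ∃ α : Cech.cocycles (xbar I) i, α.1 ∈ cochainDeg I t ∧
      Submodule.Quotient.mk α = y := Iff.rfl

theorem lcFrob_mk {I : Ideal (MvPolynomial (Fin (n + 1)) k)} (p : ℕ) [Fact p.Prime] [CharP k p]
    {i : ℕ} (α : Cech.cocycles (xbar I) i) :
    lcFrob I p i (Submodule.Quotient.mk α) = Submodule.Quotient.mk
      (Cech.frobCocycles (xbar I) p (quot_natCast_eq_zero I p) i α) := rfl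

theorem lcFrob_mem_lcDeg {I : Ideal (MvPolynomial (Fin (n + 1)) k)} (p : ℕ) [Fact p.Prime]
    [CharP k p] {i : ℕ} {t : ℤ} {y : LC I i} (hy : y ∈ lcDeg I i t) :
    lcFrob I p i y ∈ lcDeg I i (p * t) := by
  obtain ⟨α, hα, rfl⟩ := mem_lcDeg.mp hy
  exact mem_lcDeg.mpr ⟨_, frobCochain_mem_cochainDeg p (quot_natCast_eq_zero I p) hα,
      (lcFrob_mk p α).symm⟩

theorem lcBelow_le {I : Ideal (MvPolynomial (Fin (n + 1)) k)} {i : ℕ} {b : ℤ}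
    {M : AddSubgroup (LC I i)} (h : ∀ t < b, lcDeg I i t ≤ M) : lcBelow I i b ≤ M :=
  iSup₂_le h

theorem lcFrob_mem_lcBelow {I : Ideal (MvPolynomial (Fin (n + 1)) k)} (p : ℕ) [hp : Fact p.Prime]
    [CharP k p] {i : ℕ} {b : ℤ} {y : LC I i} (hy : y ∈ lcBelow I i b) :
    lcFrob I p i y ∈ lcBelow I i (p * b) := by
  refine lcBelow_le (M := (lcBelow I i (p * b)).comap (lcFrob I p i)) (fun t ht z hz => ?_) hy
  have h : (p : ℤ) * t < p * b := by
    have := hp.out.pos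
    gcongr
  exact AddSubgroup.mem_iSup_of_mem _ (AddSubgroup.mem_iSup_of_mem h (lcFrob_mem_lcDeg p hz))

namespace ResiduePairing

variable {p : ℕ} [hp : Fact p.Prime] [CharP k p] {J : Ideal (MvPolynomial (Fin (n + 1)) k)} {i : ℕ}
  {a : ℤ} {F : MvPolynomial (Fin (n + 1)) k}

/-- The functional on `S` attached to a local cohomology class. -/
def lcDual (P : ResiduePairing p J i a F) : LC J i →+ (MvPolynomial (Fin (n + 1)) k →ₗ[k] k) :=
  QuotientAddGroup.lift
    ((Cech.coboundaries (xbar J) i).submoduleOf (Cech.cocycles (xbar J) i)).toAddSubgroup P.toDual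
    fun α hα => (P.eq_zero_iff α).mpr hα

theorem lcDual_mk (P : ResiduePairing p J i a F) (α : Cech.cocycles (xbar J) i) :
    P.lcDual (Submodule.Quotient.mk α) = P.toDual α := rfl

theorem lcDual_injective (P : ResiduePairing p J i a F) : Function.Injective P.lcDual := by
  rw [injective_iff_map_eq_zero]
  intro y hy
  obtain ⟨α, rfl⟩ := Submodule.Quotient.mk_surjective _ y
  rw [lcDual_mk] at hy
  exact (Submodule.Quotient.mk_eq_zero _).mpr ((P.eq_zero_iff α).mp hy)

theorem lcDual_of_mem (P : ResiduePairing p J i a F) (y : LC J i) {g : MvPolynomial (Fin (n + 1)) k}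
    (hg : g ∈ J) :
    P.lcDual y g = 0 := by
  obtain ⟨α, rfl⟩ := Submodule.Quotient.mk_surjective _ y
  have h1 := P.scale g α 1
  have h2 : Cech.scaleCocycle (Ideal.Quotient.mk J g) α = 0 := by
    rw [Ideal.Quotient.eq_zero_iff_mem.mpr hg]
    exact Subtype.ext (Cech.zero_scale _)
  rw [h2, map_zero, mul_one] at h1
  exact h1.symm

theorem lcDual_degree (P : ResiduePairing p J i a F) {t D : ℤ} {y : LC J i} (hy : y ∈ lcDeg J i t)
    {g : MvPolynomial (Fin (n + 1)) k} (hg : g ∈ polyDeg k n D) (h : t + D ≠ a) :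
    P.lcDual y g = 0 := by
  obtain ⟨α, hα, rfl⟩ := mem_lcDeg.mp hy
  exact P.degree t D α g hα hg h

theorem exists_lcDual_eq (P : ResiduePairing p J i a F) (D : ℤ)
    (θ : MvPolynomial (Fin (n + 1)) k →ₗ[k] k)
    (hθ : ∀ g ∈ J, θ g = 0) (hD : ∀ g, θ (comp D g) = θ g) :
    ∃ y ∈ lcDeg J i (a - D), P.lcDual y = θ := by
  obtain ⟨α, hα, h⟩ := P.surjective D θ hθ hD
  exact ⟨_, mem_lcDeg.mpr ⟨α, hα, rfl⟩, h⟩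

theorem lcDual_lcFrob (P : ResiduePairing p J i a F) (y : LC J i)
    (h : MvPolynomial (Fin (n + 1)) k) :
    P.lcDual (lcFrob J p i y) h = frobDual p (P.lcDual y) (F ^ (p - 1) * h) := by
  obtain ⟨α, rfl⟩ := Submodule.Quotient.mk_surjective _ y
  exact P.frob α h

/-- Combines the twist by `F ^ (p - 1)` with the adjointness of Frobenius and Cartier maps. -/
theorem lcFrob_eq_zero_iff (P : ResiduePairing p J i a F) (y : LC J i) :
    lcFrob J p i y = 0 ↔ ∀ g ∈ cartierIdeal p (F ^ (p - 1)), P.lcDual y g = 0 := by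
  rw [← frobDual_mul_eq_zero_iff, ← map_eq_zero_iff _ P.lcDual_injective, LinearMap.ext_iff]
  exact forall_congr' fun h => by rw [lcDual_lcFrob]; rfl

theorem lcDual_degree_below (P : ResiduePairing p J i a F) {b D : ℤ} {y : LC J i}
    (hy : y ∈ lcBelow J i b)
    {g : MvPolynomial (Fin (n + 1)) k} (hg : g ∈ polyDeg k n D) (h : D ≤ a - b) :
    P.lcDual y g = 0 := by
  let M : AddSubgroup (LC J i) :=
    ((AddMonoidHom.eval g).comp (LinearMap.toAddMonoidHom'.comp P.lcDual)).ker
  exact lcBelow_le (M := M) (fun t ht z hz => P.lcDual_degree hz hg (by omega)) hy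

/-- Degree `a` is attained by the constant coefficient, a functional living on `S_0` that kills `J ⊆
𝔪`. A nonzero class of degree `t` is nonzero on some `S_m` with `m = a - t`, and `m ≥ 0`. -/
theorem isGreatest (P : ResiduePairing p J i a F) (hJ : J ≤ irrelevant k n) :
    IsGreatest {t | lcDeg J i t ≠ ⊥} a := by
  constructor
  · obtain ⟨y, hy, h⟩ := P.exists_lcDual_eq 0 (lcoeff k 0)
      (fun g hg => mem_irrelevant.mp (hJ hg)) fun g => by
        rw [lcoeff_apply, lcoeff_apply, coeff_comp, if_pos (by simp)]
    rw [sub_zero] at hy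
    intro hbot
    rw [hbot, AddSubgroup.mem_bot] at hy
    rw [hy, map_zero] at h
    have h1 := LinearMap.congr_fun h 1
    rw [lcoeff_apply, coeff_zero_one, LinearMap.zero_apply] at h1
    exact zero_ne_one h1
  · intro t ht
    obtain ⟨⟨y, hy⟩, hne⟩ := AddSubgroup.ne_bot_iff_exists_ne_zero.mp ht
    have hne' : P.lcDual y ≠ 0 := fun h => hne <| Subtype.ext <|
      P.lcDual_injective (h.trans (map_zero _).symm)
    obtain ⟨g, hg⟩ := DFunLike.ne_iff.mp hne'
    obtain ⟨m, hm⟩ := exists_apply_comp_ne_zero _ hg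
    have : t + m = a := by
      by_contra h
      exact hm (P.lcDual_degree hy (comp_mem _ _) h)
    omega

/-- The Frobenius action is injective in degrees below `a - reg (S/τ)`, where `τ` is the sum of
`J` and the Cartier ideal of `F ^ (p - 1)`. -/
theorem lcFrob_injOn (P : ResiduePairing p J i a F) {τ : Ideal (MvPolynomial (Fin (n + 1)) k)}
    (hτ : τ = J ⊔ cartierIdeal p (F ^ (p - 1))) {r : ℤ}
    (hr : ∀ D, r < D → ∀ g ∈ polyDeg k n D, g ∈ τ) :
    Set.InjOn (lcFrob J p i) (lcBelow J i (a - r)) := by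
  intro y hy z hz hyz
  have h1 := sub_mem hy hz
  rw [← sub_eq_zero]
  have h2 : lcFrob J p i (y - z) = 0 := by rw [map_sub, hyz, sub_self]
  generalize y - z = w at h1 h2
  rw [P.lcFrob_eq_zero_iff] at h2
  -- The functional of a class in the kernel of Frobenius kills `J` and the Cartier ideal, hence
  -- `τ`.
  have h3 : τ.restrictScalars k ≤ LinearMap.ker (P.lcDual w) := by
    intro g hg
    rw [Submodule.restrictScalars_mem, hτ] at hg
    obtain ⟨u, hu, v, hv, rfl⟩ := Submodule.mem_sup.mp hg
    rw [LinearMap.mem_ker, map_add, P.lcDual_of_mem w hu, h2 v hv, add_zero]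
  refine P.lcDual_injective ?_
  rw [map_zero]
  by_contra hne
  obtain ⟨g, hg⟩ := DFunLike.ne_iff.mp hne
  obtain ⟨m, hm⟩ := exists_apply_comp_ne_zero _ hg
  -- In degrees at most `r` the functional vanishes because all degrees of `w` are below `a - r`; in
  -- larger degrees every polynomial lies in `τ`.
  rcases le_or_gt (m : ℤ) r with h | h
  · exact hm (P.lcDual_degree_below h1 (comp_mem _ _) (by omega))
  · exact hm (h3 (hr m h _ (comp_mem _ _)))

/-- A form of degree `r` outside `τ` is detected by a functional on `S/τ`. Its restriction to degree
`r` still kills `τ` because `τ` is homogeneous, and the corresponding class has degree `a - r`. -/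
theorem exists_lcFrob_eq_zero (P : ResiduePairing p J i a F)
    {τ : Ideal (MvPolynomial (Fin (n + 1)) k)}
    (hτ : τ = J ⊔ cartierIdeal p (F ^ (p - 1)))
    (hhom : ∀ g ∈ τ, ∀ m, homogeneousComponent m g ∈ τ) {r : ℤ} (hr : quotDeg τ r ≠ ⊥) :
    ∃ y ∈ lcDeg J i (a - r), y ≠ 0 ∧ lcFrob J p i y = 0 := by
  rw [Ne, quotDeg_eq_bot_iff] at hr
  push Not at hr
  obtain ⟨g, hg, hgτ⟩ := hr
  obtain ⟨θ, hθg, hθ⟩ := Submodule.exists_le_ker_of_notMem (p := τ.restrictScalars k) hgτ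
  have h1 : ∀ h ∈ τ, (θ ∘ₗ comp r) h = 0 := fun h hh => hθ (comp_mem_ideal hhom hh r)
  obtain ⟨y, hy, hyθ⟩ := P.exists_lcDual_eq r (θ ∘ₗ comp r)
    (fun h hh => h1 h (by rw [hτ]; exact Ideal.mem_sup_left hh))
    fun h => by
      rw [LinearMap.comp_apply, LinearMap.comp_apply, comp_eq_self (comp_mem r h)]
  refine ⟨y, hy, ?_, ?_⟩
  · rintro rfl
    rw [map_zero] at hyθ
    have := LinearMap.congr_fun hyθ g
    rw [LinearMap.comp_apply, comp_eq_self hg] at this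
    exact hθg this.symm
  · rw [P.lcFrob_eq_zero_iff]
    intro h hh
    rw [hyθ]
    exact h1 h (by rw [hτ]; exact Ideal.mem_sup_right hh)

end ResiduePairing

/-- The sum of `J` and the Cartier ideal of `g` is the smallest ideal `I ⊇ J` with `g ∈ I ^ [p]`. -/
theorem isLeast_sup_cartierIdeal {σ : Type*} (p : ℕ) [Fact p.Prime] [CharP k p]
    (J : Ideal (MvPolynomial σ k)) (g : MvPolynomial σ k) :
    IsLeast {I | J ≤ I ∧ g ∈ frobPower p I} (J ⊔ cartierIdeal p g) := by
  refine ⟨⟨le_sup_left, ?_⟩, fun I hI => sup_le hI.1 (cartierIdeal_le p hI.2)⟩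
  refine Ideal.span_mono ?_ (mem_frobPower_cartierIdeal p g)
  rintro _ ⟨a, ha, rfl⟩
  exact ⟨a, Ideal.mem_sup_right ha, rfl⟩

theorem homogeneousComponent_mem_sup_cartierIdeal {p : ℕ} (hp : p ≠ 0)
    {s : Set (MvPolynomial (Fin (n + 1)) k)} (hs : ∀ g ∈ s, ∃ m, g.IsHomogeneous m)
    {g : MvPolynomial (Fin (n + 1)) k} {m : ℕ} (hg : g.IsHomogeneous m) :
    ∀ h ∈ Ideal.span s ⊔ cartierIdeal p g, ∀ m,
      homogeneousComponent m h ∈ Ideal.span s ⊔ cartierIdeal p g := by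
  rw [cartierIdeal, ← Ideal.span_union]
  refine homogeneousComponent_mem_span ?_
  rintro _ (h | ⟨ψ, r, hψ, rfl⟩)
  · exact hs _ h
  · exact isHomogeneous_cartier p r hp hg

end Graded

theorem theorem3p2 {k : Type*} [Field k] (p : ℕ) [Fact p.Prime] [CharP k p] (n c : ℕ)
    (f : Fin c → MvPolynomial (Fin (n + 1)) k) (e : Fin c → ℕ)
    (hf : ∀ i, (f i).IsHomogeneous (e i))
    (hreg : RingTheory.Sequence.IsRegular (MvPolynomial (Fin (n + 1)) k) (List.ofFn f))
    (J : Ideal (MvPolynomial (Fin (n + 1)) k)) (hJ : J = Ideal.span (Set.range f)) :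
    -- `a(R)` is a maximum, and has the expected value
    IsGreatest {t | Graded.lcDeg J (Graded.dim J) t ≠ ⊥} (Graded.aInvariant J) ∧
    Graded.aInvariant J = (∑ i, (e i : ℤ)) - (n + 1) ∧
    -- the smallest ideal `τ` exists and is homogeneous
    ∃ τ : Ideal (MvPolynomial (Fin (n + 1)) k),
      IsLeast {I | J ≤ I ∧ (∏ i, f i) ^ (p - 1) ∈ Graded.frobPower p I} τ ∧
      (∀ g ∈ τ, ∀ m, MvPolynomial.homogeneousComponent m g ∈ τ) ∧
      (τ.radical = Graded.irrelevant k n →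
        -- `reg (S/τ)` is a maximum
        IsGreatest {t | Graded.quotDeg τ t ≠ ⊥} (Graded.reg (Graded.quotDeg τ)) ∧
        -- Frobenius maps the part of degree `< b` injectively to the part of degree `< p b`
        (∀ b : ℤ, b = Graded.aInvariant J - Graded.reg (Graded.quotDeg τ) →
          Set.MapsTo (Graded.lcFrob J p (n + 1 - c)) (Graded.lcBelow J (n + 1 - c) b)
            (Graded.lcBelow J (n + 1 - c) (p * b)) ∧
          Set.InjOn (Graded.lcFrob J p (n + 1 - c)) (Graded.lcBelow J (n + 1 - c) b) ∧
          -- and the bound is sharp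
          ∃ α ∈ Graded.lcDeg J (n + 1 - c) b, α ≠ 0 ∧ Graded.lcFrob J p (n + 1 - c) α = 0)) := by
  have hp : p ≠ 0 := (Fact.out : p.Prime).ne_zero
  have hne : J ≠ ⊤ := by
    have h := hreg.top_ne_smul
    rw [Graded.ofList_ofFn, ← hJ, smul_eq_mul, Ideal.mul_top] at h
    exact h.symm
  have hhom : ∀ g ∈ J, ∀ m, MvPolynomial.homogeneousComponent m g ∈ J := by
    rw [hJ]
    exact Graded.homogeneousComponent_mem_span_range hf
  obtain ⟨hc, hdim⟩ : c ≤ n + 1 ∧ Graded.dim J = n + 1 - c := by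
    subst hJ
    exact Graded.ringKrullDim_quotient_regular hf hreg.toIsWeaklyRegular hne
  obtain ⟨P⟩ := Graded.nonempty_residuePairing p hc hf hreg.toIsWeaklyRegular
  rw [← hJ] at P
  have hmax := P.isGreatest (Graded.le_irrelevant hhom hne)
  rw [← hdim] at hmax
  have ha : Graded.aInvariant J = (∑ i, (e i : ℤ)) - (n + 1) := hmax.csSup_eq
  have hτ : ∀ g ∈ J ⊔ Graded.cartierIdeal p ((∏ i, f i) ^ (p - 1)), ∀ m,
      MvPolynomial.homogeneousComponent m g ∈
        J ⊔ Graded.cartierIdeal p ((∏ i, f i) ^ (p - 1)) := by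
    rw [hJ]
    refine Graded.homogeneousComponent_mem_sup_cartierIdeal hp ?_
      ((MvPolynomial.IsHomogeneous.prod Finset.univ f e fun i _ => hf i).pow (p - 1))
    rintro _ ⟨i, rfl⟩
    exact ⟨e i, hf i⟩
  refine ⟨ha ▸ hmax, ha, _, Graded.isLeast_sup_cartierIdeal p J _, hτ, fun hrad => ?_⟩
  have hr := Graded.isGreatest_reg_quotDeg hrad
  refine ⟨hr, ?_⟩
  rintro _ rfl
  rw [ha]
  refine ⟨fun y hy => Graded.lcFrob_mem_lcBelow p hy, P.lcFrob_injOn rfl fun D hD => ?_,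
    P.exists_lcFrob_eq_zero rfl hτ hr.1⟩
  -- Above `reg (S/τ)` the graded pieces vanish by maximality.
  rw [← Graded.quotDeg_eq_bot_iff]
  by_contra h
  exact absurd (hr.2 h) (not_le.mpr hD)

end
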